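/- Let $D=[0,1]^2$ and, for an integer $l>1$, let $h=1/l$ and let $\mathcal T_h$ be the uniform mesh of $D$ by the closed cells $T=h(k+[0,1]^2)$, $k\in\{0,\dots,l-1\}^2$; let $z_T$ be the centre of $T$. For an integrable function $v$ let $a_T(v)=\frac1{|T|}\int_T v$, with the same notation for the cells $h(k+[0,1]^2)$, $k\in\mathbb Z^2$, of the extended grid, and let $S_T$ be the $3\times3$ stencil of cells of that grid centred at $T$. For $s>0$ write $s=n+\alpha$ with $n\in\mathbb N_0$ and $0<\alpha\le 1$, and for $\psi\in C^n([-R,R])$ set $$\|\psi\|_{\mathcal C^s}=\max_{0\le j\le n}\|\psi^{(j)}\|_{L^\infty([-R,R])}+\sup_{x\neq y\in[-R,R]}\frac{|\psi^{(n)}(x)-\psi^{(n)}(y)|}{|x-y|^{\alpha}}$$ (so for integer $s$ the class $\mathcal C^s$ consists of functions with Lipschitz derivatives up to order $s-1$). A set $\Omega\subset\mathbb R^2$ is of class $\mathcal C^s$ if there are $R>0$, $P>1$, $M>0$ such that for every $z_0\in\partial\Omega$ there are an orthonormal system $(e_1,e_2)$ and a function $\psi:[-R,R]\to[-PR,PR]$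 with $\|\psi\|_{\mathcal C^s}\le M$ such that, for all $|z_1|\le R$ and $|z_2|\le PR$, one has $z_0+z_1e_1+z_2e_2\in\Omega$ if and only if $z_2\le\psi(z_1)$. Let $V_T$ be the set of characteristic functions $\chi_H$ of half-planes $H=\{z:\langle z-z_T,e_\theta\rangle\le r\}$, $r,\theta\in\mathbb R$, $e_\theta=(-\sin\theta,\cos\theta)$, whose boundary line meets $T$. For $\Omega\subset D$ and $u=\chi_\Omega$, a LVIRA reconstruction of $u$ on $\mathcal T_h$ is a function $\tilde u=\sum_{T\in\mathcal T_h}\tilde u_T\chi_T$ such that $$\tilde u_T\in\operatorname*{argmin}_{v\in V_T}\ \sum_{\tilde T\in S_T}|a_{\tilde T}(u)-a_{\tilde T}(v)|^2$$ if $T$ is singular, that is, if $|T\cap\Omega|\ne0$ and $|T\cap\Omega^c|\neq0$, and $\tilde u_T=a_T(u)$ otherwise. (For stencil cells outside $D$ the average of $u$ is $0$, since $\Omega\subset D$.) Let $s\ge1$ and let $\Omega\subset D$ be of class $\mathcal C^s$. Then for every $l>1$ a LVIRA reconstruction of $u=\chi_\Omega$ exists, and there is a constant $C$, depending on $\Omega$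 and $s$ but not on $h$, such that for every $h=1/l$ with $l>1$ and every LVIRA reconstruction $\tilde u$ of $u$ on $\mathcal T_h$, $$\|u-\tilde u\|_{L^1(D)}\le C\,h^{r},\qquad r=\min\{s,2\}.$$ -/

import Mathlib

open MeasureTheory

noncomputable section

namespace LVIRA

/-- The Euclidean plane. -/
abbrev Plane : Type := EuclideanSpace ℝ (Fin 2)

/-- The computational domain `D = [0,1]²`. -/
def unitSquare : Set Plane := {z | ∀ i, 0 ≤ z i ∧ z i ≤ 1}

/-! ### Domains of class `C^s` -/

/-- `ψ ∈ C^s([-R,R])` with Hölder norm at most `M`, for `s > 0`. Write `s = n + α` with `n` a natural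
number and `0 < α ≤ 1`, so that `n = ⌈s⌉ - 1`; for an integer `s` this is the convention
that `C^s` means Lipschitz derivatives up to order `s - 1`. The number `A` bounds the sup norms of the
derivatives of order at most `n`, the number `B` bounds the `α`-Hölder seminorm of the `n`-th one,
and the norm is the sum of the two. -/
def HolderNormLE (s R M : ℝ) (ψ : ℝ → ℝ) : Prop :=
  ContDiffOn ℝ ((⌈s⌉₊ - 1 : ℕ) : WithTop ℕ∞) ψ (Set.Icc (-R) R) ∧
  ∃ A B : ℝ, A + B ≤ M ∧
    (∀ j ≤ ⌈s⌉₊ - 1, ∀ x ∈ Set.Icc (-R) R, |iteratedDerivWithin j ψ (Set.Icc (-R) R) x| ≤ A) ∧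
    (∀ x ∈ Set.Icc (-R) R, ∀ y ∈ Set.Icc (-R) R,
      |iteratedDerivWithin (⌈s⌉₊ - 1) ψ (Set.Icc (-R) R) x
          - iteratedDerivWithin (⌈s⌉₊ - 1) ψ (Set.Icc (-R) R) y|
        ≤ B * |x - y| ^ (s - ((⌈s⌉₊ - 1 : ℕ) : ℝ)))

/-- `Ω ⊆ ℝ²` is of class `C^s`: near each boundary point it is, in a suitable orthonormal system
centred there, the subgraph of a `C^s` function, with uniform constants `R`, `P`, `M`. -/
def IsClassC (s : ℝ) (Ω : Set Plane) : Prop :=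
  ∃ R P M : ℝ, 0 < R ∧ 1 < P ∧ 0 < M ∧
    ∀ z₀ ∈ frontier Ω, ∃ (e : OrthonormalBasis (Fin 2) ℝ Plane) (ψ : ℝ → ℝ),
      HolderNormLE s R M ψ ∧
      (∀ x ∈ Set.Icc (-R) R, ψ x ∈ Set.Icc (-(P * R)) (P * R)) ∧
      ∀ z₁ z₂ : ℝ, |z₁| ≤ R → |z₂| ≤ P * R →
        (z₀ + z₁ • e 0 + z₂ • e 1 ∈ Ω ↔ z₂ ≤ ψ z₁)

/-! ### Cartesian meshes and cell averages -/

/-- The closed cell `h (k + [0,1]²)`. -/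
def cell (h : ℝ) (k : Fin 2 → ℤ) : Set Plane :=
  {z | ∀ i, h * k i ≤ z i ∧ z i ≤ h * (k i + 1)}

/-- The centre of the cell `h (k + [0,1]²)`. -/
def cellCenter (h : ℝ) (k : Fin 2 → ℤ) : Plane :=
  WithLp.toLp 2 fun i => h * (k i + 1 / 2)

/-- Indices of the cells of the mesh of `[0,1]²` of side-length `1 / l`: `{0, …, l-1}²`. -/
def mesh (l : ℕ) : Finset (Fin 2 → ℤ) :=
  Fintype.piFinset fun _ => Finset.Ico 0 (l : ℤ)

/-- Indices of the nine cells of the `3 × 3` stencil centred at the cell of index `k`. -/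
def stencil (k : Fin 2 → ℤ) : Finset (Fin 2 → ℤ) := Finset.Icc (k - 1) (k + 1)

/-- The characteristic function of a set. -/
def chi (A : Set Plane) : Plane → ℝ := A.indicator 1

/-- The cell average `a_T(u)`. -/
def cellAverage (h : ℝ) (k : Fin 2 → ℤ) (u : Plane → ℝ) : ℝ := ⨍ z in cell h k, u z

/-- The cell is singular: both `Ω` and its complement occupy a part of positive area of it. -/
def IsSingular (h : ℝ) (k : Fin 2 → ℤ) (Ω : Set Plane) : Prop :=
  volume (cell h k ∩ Ω) ≠ 0 ∧ volume (cell h k ∩ Ωᶜ) ≠ 0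

/-! ### LVIRA -/

/-- The unit normal vector `e_θ = (-sin θ, cos θ)`. -/
def normal (θ : ℝ) : Plane := !₂[-Real.sin θ, Real.cos θ]

/-- The family of linear interfaces used on the cell `T` of index `k`: characteristic functions of
half-planes `{z : ⟨z - z_T, e_θ⟩ ≤ r}` whose boundary line passes through `T`. -/
def linearInterfaces (h : ℝ) (k : Fin 2 → ℤ) : Set (Plane → ℝ) :=
  {v | ∃ r θ : ℝ, (∃ z ∈ cell h k, inner ℝ (z - cellCenter h k) (normal θ) = r) ∧
    v = chi {z | inner ℝ (z - cellCenter h k) (normal θ) ≤ r}}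

/-- The least-squares loss between the averages of `u` and `v` on the stencil centred at `k`. -/
def loss (h : ℝ) (k : Fin 2 → ℤ) (u v : Plane → ℝ) : ℝ :=
  ∑ j ∈ stencil k, (cellAverage h j u - cellAverage h j v) ^ 2

/-- `w` is a LVIRA recovery on the cell of index `k`: on a singular cell, a linear interface through
the cell that minimizes the loss among all of these; on a regular cell, the constant average. -/
def IsLocalRecovery (h : ℝ) (k : Fin 2 → ℤ) (Ω : Set Plane) (w : Plane → ℝ) : Prop :=
  (IsSingular h k Ω → w ∈ linearInterfaces h k ∧
    IsMinOn (loss h k (chi Ω)) (linearInterfaces h k) w) ∧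
  (¬ IsSingular h k Ω → w = fun _ => cellAverage h k (chi Ω))

/-- `ũ = ∑_T ũ_T χ_T` is a LVIRA reconstruction of the characteristic function of `Ω` on the mesh of
side-length `1 / l`. For `Ω ⊆ [0,1]²` the averages on the stencil cells outside `[0,1]²` vanish. -/
def IsReconstruction (l : ℕ) (Ω : Set Plane) (u' : Plane → ℝ) : Prop :=
  ∃ w : (Fin 2 → ℤ) → Plane → ℝ,
    (∀ k ∈ mesh l, IsLocalRecovery (1 / (l : ℝ)) k Ω (w k)) ∧
    u' = fun z => ∑ k ∈ mesh l, w k z * chi (cell (1 / (l : ℝ)) k) z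

end LVIRA

end

/-! Put r = min(s, 2). The error vanishes on regular cells, so it suffices that there are O(1/h)
singular cells and that each carries an error O(h^(1+r)).

A singular cell T contains a boundary point, since T is connected. The half-plane under the tangent
at that point is admissible on T and, on the whole stencil, differs from Ω only in a strip of length
O(h) and width O(h^r) (`IsLocalGraph.exists_halfPlane`). A minimizer has no larger loss, so in every
stencil cell its area is within O(h^(1+r)) of that of the tangent half-plane.

The heart of the proof turns this closeness of nine areas into L¹ closeness on T
(`inverse_inequality`). Where one half-plane contains the other, the area of the symmetric
difference is the difference of the areas. Otherwise the signs of the products of corresponding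
normal components decide. Both nonpositive: a corner cell lies in one half-plane and, up to its
edges, outside the other. One nonpositive: translations by ±h along that axis carry the two halves
of the difference into two neighbours of T, where the half-planes are nested. Both positive: the
lines cross in T, the difference is a cone, and dilation by 2 about its apex bounds it by its part
in the outer cells.

The count holds because the boundary is covered by finitely many Lipschitz graphs
(`IsClassC.exists_card_le`). Minimizers exist because the admissible lines have a compact parameter
space on which the loss is continuous (`exists_isMinOn_loss`). -/

noncomputable section

namespace LVIRA

/-! ### Cells -/

/-- The open cell `h (k + (0,1)²)`. -/
def openCell (h : ℝ) (k : Fin 2 → ℤ) : Set Plane :=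
  {z | ∀ i, h * k i < z i ∧ z i < h * (k i + 1)}

theorem cell_eq_preimage (h : ℝ) (k : Fin 2 → ℤ) :
    cell h k = WithLp.ofLp ⁻¹'
      Set.Icc (fun i => h * (k i : ℝ)) (fun i => h * ((k i : ℝ) + 1)) := by
  ext z
  simp only [cell, Set.mem_ofPred_eq, Set.mem_preimage, Set.mem_Icc, Pi.le_def]
  exact forall_and

theorem openCell_eq_preimage (h : ℝ) (k : Fin 2 → ℤ) :
    openCell h k = WithLp.ofLp ⁻¹'
      Set.univ.pi fun i => Set.Ioo (h * (k i : ℝ)) (h * ((k i : ℝ) + 1)) := by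
  ext z
  simp [openCell]

theorem isCompact_cell (h : ℝ) (k : Fin 2 → ℤ) : IsCompact (cell h k) := by
  rw [cell_eq_preimage]
  exact (PiLp.homeomorph 2 (fun _ : Fin 2 => ℝ)).isCompact_preimage.2 isCompact_Icc

theorem measurableSet_cell (h : ℝ) (k : Fin 2 → ℤ) : MeasurableSet (cell h k) :=
  (isCompact_cell h k).isClosed.measurableSet

theorem measurableSet_openCell (h : ℝ) (k : Fin 2 → ℤ) : MeasurableSet (openCell h k) := by
  rw [openCell_eq_preimage]
  exact (PiLp.volume_preserving_ofLp (Fin 2)).measurable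
    (MeasurableSet.univ_pi fun _ => measurableSet_Ioo)

theorem volume_cell {h : ℝ} (hh : 0 ≤ h) (k : Fin 2 → ℤ) :
    volume (cell h k) = ENNReal.ofReal (h ^ 2) := by
  rw [cell_eq_preimage, (PiLp.volume_preserving_ofLp (Fin 2)).measure_preimage
    measurableSet_Icc.nullMeasurableSet, Real.volume_Icc_pi, Fin.prod_univ_two,
    ← ENNReal.ofReal_mul (by linarith)]
  congr 1
  ring

theorem volume_cell_ne_top (h : ℝ) (k : Fin 2 → ℤ) : volume (cell h k) ≠ ⊤ :=
  (isCompact_cell h k).measure_lt_top.ne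

theorem volume_cell_inter_ne_top (h : ℝ) (k : Fin 2 → ℤ) (A : Set Plane) :
    volume (cell h k ∩ A) ≠ ⊤ :=
  measure_ne_top_of_subset Set.inter_subset_left (volume_cell_ne_top h k)

theorem volume_real_cell {h : ℝ} (hh : 0 ≤ h) (k : Fin 2 → ℤ) :
    volume.real (cell h k) = h ^ 2 := by
  rw [measureReal_def, volume_cell hh, ENNReal.toReal_ofReal (sq_nonneg h)]

theorem openCell_ae_eq_cell (h : ℝ) (k : Fin 2 → ℤ) : openCell h k =ᵐ[volume] cell h k := by
  rw [openCell_eq_preimage, cell_eq_preimage]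
  exact (PiLp.volume_preserving_ofLp (Fin 2)).quasiMeasurePreserving.preimage_ae_eq
    (Measure.univ_pi_Ioo_ae_eq_Icc (μ := fun _ : Fin 2 => (volume : Measure ℝ)))

theorem convex_cell (h : ℝ) (k : Fin 2 → ℤ) : Convex ℝ (cell h k) := by
  intro x hx y hy a b ha hb hab i
  exact convex_Icc (h * (k i : ℝ)) (h * ((k i : ℝ) + 1)) (hx i) (hy i) ha hb hab

theorem mem_stencil {k j : Fin 2 → ℤ} :
    j ∈ stencil k ↔ ∀ i, j i = k i - 1 ∨ j i = k i ∨ j i = k i + 1 := by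
  simp only [stencil, Finset.mem_Icc, Pi.le_def, ← forall_and]
  refine forall_congr' fun i => ?_
  simp only [Pi.sub_apply, Pi.add_apply, Pi.one_apply]
  omega

theorem self_mem_stencil (k : Fin 2 → ℤ) : k ∈ stencil k :=
  mem_stencil.2 fun _ => .inr (.inl rfl)

theorem card_stencil (k : Fin 2 → ℤ) : (stencil k).card = 9 := by
  simp only [stencil, Pi.card_Icc, Int.card_Icc, Fin.prod_univ_two, Pi.sub_apply, Pi.add_apply,
    Pi.one_apply]
  have (m : ℤ) : (m + 1 + 1 - (m - 1)).toNat = 3 := by omega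
  rw [this, this]
  norm_num

/-! ### Half-planes -/

/-- The half-plane through `p` with outer normal vector `n`. -/
def halfPlane (p n : Plane) : Set Plane := {z | inner ℝ (z - p) n ≤ 0}

theorem inner_eq_of_ne {i j : Fin 2} (hij : i ≠ j) (x y : Plane) :
    inner ℝ x y = x i * y i + x j * y j := by
  rw [PiLp.inner_apply, Fin.sum_univ_two]
  simp only [RCLike.inner_apply, conj_trivial]
  fin_cases i <;> fin_cases j <;> first | exact absurd rfl hij | (simp; ring)

theorem mem_halfPlane_iff {i j : Fin 2} (hij : i ≠ j) {p n z : Plane} :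
    z ∈ halfPlane p n ↔ (z i - p i) * n i + (z j - p j) * n j ≤ 0 := by
  rw [halfPlane, Set.mem_ofPred_eq, inner_eq_of_ne hij]
  rfl

theorem isClosed_halfPlane (p n : Plane) : IsClosed (halfPlane p n) :=
  isClosed_le (by fun_prop) continuous_const

theorem measurableSet_halfPlane (p n : Plane) : MeasurableSet (halfPlane p n) :=
  (isClosed_halfPlane p n).measurableSet

/-- On `S`, one of the two sets is contained in the other. -/
def NestedOn (S A B : Set Plane) : Prop := S ∩ A ⊆ B ∨ S ∩ B ⊆ A

theorem abs_sub_eq_of_inter_subset {S A B : Set Plane} (hS : volume S ≠ ⊤) (hSm : MeasurableSet S)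
    (hA : MeasurableSet A) (h : S ∩ A ⊆ B) :
    volume.real (S ∩ symmDiff A B) = |volume.real (S ∩ A) - volume.real (S ∩ B)| := by
  have h1 : S ∩ symmDiff A B = (S ∩ B) \ (S ∩ A) := by
    ext z
    have := @h z
    simp only [Set.mem_inter_iff, Set.mem_symmDiff, Set.mem_sdiff] at *
    tauto
  have h2 : S ∩ A ⊆ S ∩ B := fun z hz => ⟨hz.1, h hz⟩
  have h3 : volume (S ∩ B) ≠ ⊤ := measure_ne_top_of_subset Set.inter_subset_left hS
  rw [h1, measureReal_sdiff h2 (hSm.inter hA) h3, abs_sub_comm, abs_of_nonneg]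
  exact sub_nonneg.2 (measureReal_mono h2 h3)

theorem NestedOn.volume_real_symmDiff {S A B : Set Plane} (h : NestedOn S A B)
    (hS : volume S ≠ ⊤) (hSm : MeasurableSet S) (hA : MeasurableSet A) (hB : MeasurableSet B) :
    volume.real (S ∩ symmDiff A B) = |volume.real (S ∩ A) - volume.real (S ∩ B)| := by
  rcases h with h | h
  · exact abs_sub_eq_of_inter_subset hS hSm hA h
  · rw [symmDiff_comm, abs_sub_comm]
    exact abs_sub_eq_of_inter_subset hS hSm hB h

/-- The signed comparison, in terms of the coordinate `t`, of two lines which are graphs over the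
corresponding axis. -/
def crossing (i j : Fin 2) (p n p' n' : Plane) (t : ℝ) : ℝ :=
  n' j * (n i * (p i - t) + n j * p j) - n j * (n' i * (p' i - t) + n' j * p' j)

/-- After scaling by `n' j` and `n j`, the defining affine forms have the same `z j` term, so their
difference depends on `z i` alone. As the two factors have the same sign, a constant sign of this
difference orders the half-planes. -/
theorem nestedOn_of_crossing {i j : Fin 2} (hij : i ≠ j) {p n p' n' : Plane}
    (hj : 0 < n j * n' j) {S : Set Plane}
    (hS : (∀ z ∈ S, 0 ≤ crossing i j p n p' n' (z i)) ∨
      (∀ z ∈ S, crossing i j p n p' n' (z i) ≤ 0)) :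
    NestedOn S (halfPlane p n) (halfPlane p' n') := by
  have key (z : Plane) : n j * ((z i - p' i) * n' i + (z j - p' j) * n' j) =
      n' j * ((z i - p i) * n i + (z j - p j) * n j) + crossing i j p n p' n' (z i) := by
    unfold crossing; ring
  unfold NestedOn
  simp only [Set.subset_def, Set.mem_inter_iff, mem_halfPlane_iff hij]
  rcases pos_and_pos_or_neg_and_neg_of_mul_pos hj with ⟨h1, h2⟩ | ⟨h1, h2⟩ <;>
    rcases hS with hS | hS
  · right
    rintro z ⟨hz, hz'⟩
    have := hS z hz
    have := key z
    by_contra! hc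
    nlinarith [mul_pos h2 hc]
  · left
    rintro z ⟨hz, hz'⟩
    have := hS z hz
    have := key z
    by_contra! hc
    nlinarith [mul_pos h1 hc]
  · left
    rintro z ⟨hz, hz'⟩
    have := hS z hz
    have := key z
    by_contra! hc
    nlinarith [mul_pos_of_neg_of_neg h1 (neg_lt_zero.2 hc)]
  · right
    rintro z ⟨hz, hz'⟩
    have := hS z hz
    have := key z
    by_contra! hc
    nlinarith [mul_pos_of_neg_of_neg h2 (neg_lt_zero.2 hc)]

theorem affine_sign_change {a b x y : ℝ}
    (h1 : ¬ ∀ t ∈ Set.Icc x y, 0 ≤ a + b * t) (h2 : ¬ ∀ t ∈ Set.Icc x y, a + b * t ≤ 0) :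
    b ≠ 0 ∧ ∃ t ∈ Set.Icc x y, a + b * t = 0 := by
  push Not at h1 h2
  obtain ⟨t₁, ht₁, h1⟩ := h1
  obtain ⟨t₂, ht₂, h2⟩ := h2
  have hb : b ≠ 0 := by
    rintro rfl
    linarith
  have hr : a + b * (-a / b) = 0 := by field_simp; ring
  refine ⟨hb, -a / b, ?_, hr⟩
  set t := -a / b
  simp only [Set.mem_Icc] at *
  rcases lt_or_gt_of_ne hb with hb | hb
  · have h3 : t < t₁ := by by_contra! hc; nlinarith
    have h4 : t₂ < t := by by_contra! hc; nlinarith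
    constructor <;> linarith
  · have h3 : t < t₂ := by by_contra! hc; nlinarith
    have h4 : t₁ < t := by by_contra! hc; nlinarith
    constructor <;> linarith

/-- If two half-planes are not nested on a cell, then their boundary lines cross in the strip of
that cell, and they are nested on both sides of this strip. -/
theorem exists_crossing_of_not_nestedOn {i j : Fin 2} (hij : i ≠ j) {p n p' n' : Plane}
    (hj : 0 < n j * n' j) {h : ℝ} {k : Fin 2 → ℤ}
    (hn : ¬ NestedOn (cell h k) (halfPlane p n) (halfPlane p' n')) :
    n j * n' i - n' j * n i ≠ 0 ∧
    (∃ t ∈ Set.Icc (h * k i) (h * (k i + 1)), crossing i j p n p' n' t = 0) ∧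
    (∀ S : Set Plane, (∀ z ∈ S, z i ≤ h * k i) →
      NestedOn S (halfPlane p n) (halfPlane p' n')) ∧
    (∀ S : Set Plane, (∀ z ∈ S, h * (k i + 1) ≤ z i) →
      NestedOn S (halfPlane p n) (halfPlane p' n')) := by
  set b := n j * n' i - n' j * n i with hb
  set a := crossing i j p n p' n' 0 with ha
  have hab (t : ℝ) : crossing i j p n p' n' t = a + b * t := by
    simp only [ha, hb, crossing]; ring
  have h1 : ¬ ∀ t ∈ Set.Icc (h * k i) (h * (k i + 1)), 0 ≤ a + b * t := fun hc =>
    hn <| nestedOn_of_crossing hij hj <| .inl fun z hz => by rw [hab]; exact hc _ (hz i)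
  have h2 : ¬ ∀ t ∈ Set.Icc (h * k i) (h * (k i + 1)), a + b * t ≤ 0 := fun hc =>
    hn <| nestedOn_of_crossing hij hj <| .inr fun z hz => by rw [hab]; exact hc _ (hz i)
  obtain ⟨hb0, t, ht, hroot⟩ := affine_sign_change h1 h2
  refine ⟨hb0, ⟨t, ht, by rw [hab, hroot]⟩, fun S hS => ?_, fun S hS => ?_⟩ <;>
    refine nestedOn_of_crossing hij hj ?_ <;> simp only [hab] <;>
    rcases lt_or_gt_of_ne hb0 with hb1 | hb1
  · left
    intro z hz
    nlinarith [hS z hz, ht.1]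
  · right
    intro z hz
    nlinarith [hS z hz, ht.1]
  · right
    intro z hz
    nlinarith [hS z hz, ht.2]
  · left
    intro z hz
    nlinarith [hS z hz, ht.2]

/-! ### The inverse inequality for half-planes -/

/-- The difference of the areas of two sets in a cell. -/
def areaGap (h : ℝ) (j : Fin 2 → ℤ) (A B : Set Plane) : ℝ :=
  |volume.real (cell h j ∩ A) - volume.real (cell h j ∩ B)|

theorem areaGap_nonneg (h : ℝ) (j : Fin 2 → ℤ) (A B : Set Plane) : 0 ≤ areaGap h j A B :=
  abs_nonneg _

theorem areaGap_le_sum (h : ℝ) {k j : Fin 2 → ℤ} (hj : j ∈ stencil k) (A B : Set Plane) :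
    areaGap h j A B ≤ ∑ j ∈ stencil k, areaGap h j A B :=
  Finset.single_le_sum (f := fun j => areaGap h j A B) (fun _ _ => areaGap_nonneg _ _ _ _) hj

theorem NestedOn.volume_real_cell_inter {h : ℝ} {k : Fin 2 → ℤ} {p n p' n' : Plane}
    (hn : NestedOn (cell h k) (halfPlane p n) (halfPlane p' n')) :
    volume.real (cell h k ∩ symmDiff (halfPlane p n) (halfPlane p' n')) =
      areaGap h k (halfPlane p n) (halfPlane p' n') :=
  hn.volume_real_symmDiff (volume_cell_ne_top h k) (measurableSet_cell h k)
    (measurableSet_halfPlane p n) (measurableSet_halfPlane p' n')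

theorem inverse_inequality_of_nestedOn {h : ℝ} {k : Fin 2 → ℤ} {p n p' n' : Plane}
    (hn : NestedOn (cell h k) (halfPlane p n) (halfPlane p' n')) :
    volume.real (cell h k ∩ symmDiff (halfPlane p n) (halfPlane p' n')) ≤
      ∑ j ∈ stencil k, areaGap h j (halfPlane p n) (halfPlane p' n') := by
  rw [hn.volume_real_cell_inter]
  exact areaGap_le_sum h (self_mem_stencil k) _ _

/-- Case of normal vectors in opposite quadrants: the half-planes differ on a corner cell. -/
theorem inverse_inequality_of_opposite {h : ℝ} (hh : 0 < h) {k : Fin 2 → ℤ} {p n p' n' : Plane}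
    (hp : p ∈ cell h k) (hp' : p' ∈ cell h k) (hn' : n' ≠ 0)
    (h0 : n 0 * n' 0 ≤ 0) (h1 : n 1 * n' 1 ≤ 0) :
    volume.real (cell h k ∩ symmDiff (halfPlane p n) (halfPlane p' n')) ≤
      ∑ j ∈ stencil k, areaGap h j (halfPlane p n) (halfPlane p' n') := by
  -- In each coordinate, step to the side where the first form gets a nonpositive contribution and
  -- the second a nonnegative one. The last clause supplies the strictness that, with `n' ≠ 0`,
  -- keeps the corner cell off the second half-plane.
  have hsign (i : Fin 2) : ∃ m : ℤ, (m = k i - 1 ∨ m = k i ∨ m = k i + 1) ∧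
      ∀ x ∈ Set.Ioo (h * m) (h * (m + 1)), (x - p i) * n i ≤ 0 ∧ 0 ≤ (x - p' i) * n' i ∧
        ((x - p' i) * n' i = 0 → n' i = 0) := by
    have hi : n i * n' i ≤ 0 := by fin_cases i; exacts [h0, h1]
    have hpi := hp i
    have hpi' := hp' i
    have hcase : (0 ≤ n i ∧ n' i ≤ 0) ∨ (n i ≤ 0 ∧ 0 ≤ n' i) := mul_nonpos_iff.1 hi
    rcases hcase with ⟨ha, hb⟩ | ⟨ha, hb⟩
    · refine ⟨k i - 1, .inl rfl, fun x hx => ?_⟩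
      have hx2 := hx.2
      push_cast at hx2
      rw [sub_add_cancel] at hx2
      exact ⟨mul_nonpos_of_nonpos_of_nonneg (by linarith) ha,
        mul_nonneg_of_nonpos_of_nonpos (by linarith) hb,
        fun h0 => (mul_eq_zero.1 h0).resolve_left (by linarith)⟩
    · refine ⟨k i + 1, .inr (.inr rfl), fun x hx => ?_⟩
      have hx1 := hx.1
      push_cast at hx1
      exact ⟨mul_nonpos_of_nonneg_of_nonpos (by linarith) ha,
        mul_nonneg (by linarith) hb,
        fun h0 => (mul_eq_zero.1 h0).resolve_left (by linarith)⟩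
  choose m hm hmx using hsign
  have hsub : openCell h m ⊆ halfPlane p n := fun z hz => by
    rw [mem_halfPlane_iff zero_ne_one]
    exact add_nonpos (hmx 0 _ (hz 0)).1 (hmx 1 _ (hz 1)).1
  have hdisj : openCell h m ∩ halfPlane p' n' = ∅ := by
    refine Set.eq_empty_of_forall_notMem fun z hz => hn' ?_
    have hz' := (mem_halfPlane_iff zero_ne_one).1 hz.2
    have a0 := hmx 0 _ (hz.1 0)
    have a1 := hmx 1 _ (hz.1 1)
    ext i
    fin_cases i
    · exact a0.2.2 (by linarith [a0.2.1, a1.2.1])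
    · exact a1.2.2 (by linarith [a0.2.1, a1.2.1])
  have hmem : m ∈ stencil k := mem_stencil.2 hm
  have e1 : volume.real (cell h m ∩ halfPlane p n) = h ^ 2 := by
    rw [← volume_real_cell hh.le m, ← measureReal_congr ((openCell_ae_eq_cell h m).inter
      (ae_eq_refl (halfPlane p n))), Set.inter_eq_left.2 hsub,
      measureReal_congr (openCell_ae_eq_cell h m)]
  have e2 : volume.real (cell h m ∩ halfPlane p' n') = 0 := by
    rw [← measureReal_congr ((openCell_ae_eq_cell h m).inter
      (ae_eq_refl (halfPlane p' n'))), hdisj, measureReal_empty]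
  refine le_trans ?_ (areaGap_le_sum h hmem _ _)
  rw [areaGap, e1, e2, sub_zero, abs_of_nonneg (sq_nonneg h), ← volume_real_cell hh.le k]
  exact measureReal_mono Set.inter_subset_left (volume_cell_ne_top h k)

theorem volume_real_le_of_translate {S U : Set Plane} (d : Plane) (hU : volume U ≠ ⊤)
    (h : ∀ z ∈ S, d + z ∈ U) : volume.real S ≤ volume.real U := by
  have h1 : volume.real ((fun z => d + z) ⁻¹' U) = volume.real U := by
    rw [measureReal_def, measureReal_def, measure_preimage_add]
  rw [← h1]
  refine measureReal_mono h ?_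
  rwa [measure_preimage_add]

theorem single_shift_mem {h : ℝ} {k : Fin 2 → ℤ} {i : Fin 2} (m : ℤ) {z : Plane}
    (hz : z ∈ cell h k) :
    EuclideanSpace.single i (h * m) + z ∈ cell h (k + Pi.single i m) := by
  intro i'
  have := hz i'
  by_cases hi : i' = i
  · subst hi
    simp only [PiLp.add_apply, PiLp.single_eq_same, Pi.add_apply,
      Pi.single_eq_same, Int.cast_add]
    constructor <;> linarith
  · simpa [hi] using this

theorem add_single_mem_stencil (k : Fin 2 → ℤ) (i : Fin 2) {m : ℤ} (hm : m = 1 ∨ m = -1) :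
    k + Pi.single i m ∈ stencil k := by
  refine mem_stencil.2 fun i' => ?_
  by_cases hi : i' = i
  · subst hi
    simp only [Pi.add_apply, Pi.single_eq_same]
    omega
  · simp [hi]

/-- Case of boundary lines which are monotone in opposite senses: the difference of the half-planes
grows on moving away from the cell. -/
theorem inverse_inequality_of_mixed {h : ℝ} (hh : 0 < h) {k : Fin 2 → ℤ} {p n p' n' : Plane}
    {i j : Fin 2} (hij : i ≠ j) (hi : n i * n' i ≤ 0) (hj : 0 < n j * n' j) :
    volume.real (cell h k ∩ symmDiff (halfPlane p n) (halfPlane p' n')) ≤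
      ∑ j ∈ stencil k, areaGap h j (halfPlane p n) (halfPlane p' n') := by
  by_cases hn : NestedOn (cell h k) (halfPlane p n) (halfPlane p' n')
  · exact inverse_inequality_of_nestedOn hn
  obtain ⟨-, -, hleft, hright⟩ := exists_crossing_of_not_nestedOn hij hj hn
  have hcell (m : ℤ) (hm : m = 1 ∨ m = -1) :
      NestedOn (cell h (k + Pi.single i m)) (halfPlane p n) (halfPlane p' n') := by
    rcases hm with rfl | rfl
    · refine hright _ fun z hz => ?_
      have := (hz i).1
      simpa using this
    · refine hleft _ fun z hz => ?_
      have := (hz i).2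
      simpa using this
  -- The translation adds `h * m * ν i` to the affine form, so the sign of `m * ν i` tells whether
  -- the half-plane or its complement is preserved.
  have hshift (q ν : Plane) (m : ℤ) (hm : m * ν i ≤ 0) (z : Plane) (hz : z ∈ halfPlane q ν) :
      EuclideanSpace.single i (h * m) + z ∈ halfPlane q ν := by
    rw [mem_halfPlane_iff hij] at hz ⊢
    have e1 : (EuclideanSpace.single i (h * (m : ℝ)) + z) i = h * m + z i := by simp
    have e2 : (EuclideanSpace.single i (h * (m : ℝ)) + z) j = z j := by
      simp [hij.symm]
    rw [e1, e2]
    nlinarith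
  have hshift' (q ν : Plane) (m : ℤ) (hm : 0 ≤ m * ν i) (z : Plane) (hz : z ∉ halfPlane q ν) :
      EuclideanSpace.single i (h * m) + z ∉ halfPlane q ν := by
    intro hc
    apply hz
    have := hshift q ν (-m) (by push_cast; linarith) _ hc
    convert this using 1
    ext i'
    by_cases hi' : i' = i <;> simp [hi']
  -- Direction `m₁` preserves the first half-plane and the complement of the second, and `m₂` the
  -- reverse. Being distinct, they hit two different terms of the sum.
  have hmain : ∃ m₁ m₂ : ℤ, m₁ ≠ m₂ ∧ (m₁ = 1 ∨ m₁ = -1) ∧ (m₂ = 1 ∨ m₂ = -1) ∧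
      m₁ * n i ≤ 0 ∧ 0 ≤ m₁ * n' i ∧ 0 ≤ m₂ * n i ∧ m₂ * n' i ≤ 0 := by
    rcases mul_nonpos_iff.1 hi with ⟨ha, hb⟩ | ⟨ha, hb⟩
    · refine ⟨-1, 1, by norm_num, by norm_num, by norm_num, ?_, ?_, ?_, ?_⟩ <;> push_cast <;>
        linarith
    · refine ⟨1, -1, by norm_num, by norm_num, by norm_num, ?_, ?_, ?_, ?_⟩ <;> push_cast <;>
        linarith
  obtain ⟨m₁, m₂, hne, hm₁, hm₂, c1, c2, c3, c4⟩ := hmain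
  set A := halfPlane p n
  set B := halfPlane p' n'
  have hfin (j : Fin 2 → ℤ) := volume_cell_inter_ne_top h j (symmDiff A B)
  have b1 : volume.real (cell h k ∩ (A \ B)) ≤ areaGap h (k + Pi.single i m₁) A B := by
    rw [← (hcell m₁ hm₁).volume_real_cell_inter]
    refine volume_real_le_of_translate (EuclideanSpace.single i (h * m₁)) (hfin _) fun z hz => ?_
    exact ⟨single_shift_mem m₁ hz.1, .inl ⟨hshift _ _ _ c1 _ hz.2.1, hshift' _ _ _ c2 _ hz.2.2⟩⟩
  have b2 : volume.real (cell h k ∩ (B \ A)) ≤ areaGap h (k + Pi.single i m₂) A B := by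
    rw [← (hcell m₂ hm₂).volume_real_cell_inter]
    refine volume_real_le_of_translate (EuclideanSpace.single i (h * m₂)) (hfin _) fun z hz => ?_
    exact ⟨single_shift_mem m₂ hz.1, .inr ⟨hshift _ _ _ c4 _ hz.2.1, hshift' _ _ _ c3 _ hz.2.2⟩⟩
  have hsum : areaGap h (k + Pi.single i m₁) A B + areaGap h (k + Pi.single i m₂) A B ≤
      ∑ j ∈ stencil k, areaGap h j A B := by
    have hne' : k + Pi.single i m₁ ≠ k + Pi.single i m₂ := fun hc => hne <| by
      simpa using congr_fun hc i
    rw [← Finset.sum_pair (f := fun j => areaGap h j A B) hne']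
    refine Finset.sum_le_sum_of_subset_of_nonneg ?_ fun _ _ _ => areaGap_nonneg _ _ _ _
    intro x hx
    rcases Finset.mem_insert.1 hx with rfl | hx
    · exact add_single_mem_stencil k i hm₁
    · rw [Finset.mem_singleton.1 hx]
      exact add_single_mem_stencil k i hm₂
  calc volume.real (cell h k ∩ symmDiff A B)
      = volume.real (cell h k ∩ (A \ B) ∪ cell h k ∩ (B \ A)) := by
        rw [← Set.inter_union_distrib_left]; rfl
    _ ≤ _ := measureReal_union_le _ _
    _ ≤ _ := (add_le_add b1 b2).trans hsum

theorem exists_mem_stencil_cell {h : ℝ} {k : Fin 2 → ℤ} {z : Plane}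
    (hz : ∀ i, h * (k i - 1) ≤ z i ∧ z i ≤ h * (k i + 2)) : ∃ j ∈ stencil k, z ∈ cell h j := by
  have hcoord (i : Fin 2) : ∃ m : ℤ, (m = k i - 1 ∨ m = k i ∨ m = k i + 1) ∧
      h * m ≤ z i ∧ z i ≤ h * (m + 1) := by
    have := hz i
    rcases le_total (z i) (h * k i) with h1 | h1
    · exact ⟨k i - 1, .inl rfl, by push_cast; linarith, by push_cast; linarith⟩
    rcases le_total (z i) (h * (k i + 1)) with h2 | h2
    · exact ⟨k i, .inr (.inl rfl), h1, h2⟩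
    · exact ⟨k i + 1, .inr (.inr rfl), by push_cast; linarith, by push_cast; linarith⟩
  choose m hm hmz using hcoord
  exact ⟨m, mem_stencil.2 hm, hmz⟩

/-- Case of normal vectors in the same quadrant: if the lines cross in the cell, then the difference
of the half-planes is a cone, and it is controlled by its part in the outer cells. -/
theorem inverse_inequality_of_same {h : ℝ} {k : Fin 2 → ℤ} {p n p' n' : Plane}
    (h0 : 0 < n 0 * n' 0) (h1 : 0 < n 1 * n' 1) :
    volume.real (cell h k ∩ symmDiff (halfPlane p n) (halfPlane p' n')) ≤
      ∑ j ∈ stencil k, areaGap h j (halfPlane p n) (halfPlane p' n') := by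
  by_cases hn : NestedOn (cell h k) (halfPlane p n) (halfPlane p' n')
  · exact inverse_inequality_of_nestedOn hn
  obtain ⟨hdet, ⟨t₀, ht₀, hr₀⟩, hl₀, hu₀⟩ :=
    exists_crossing_of_not_nestedOn (i := 0) (j := 1) zero_ne_one h1 hn
  obtain ⟨-, ⟨t₁, ht₁, hr₁⟩, hl₁, hu₁⟩ :=
    exists_crossing_of_not_nestedOn (i := 1) (j := 0) one_ne_zero h0 hn
  set q : Plane := !₂[t₀, t₁] with hq
  have hq0 : q 0 = t₀ := rfl
  have hq1 : q 1 = t₁ := rfl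
  have hqc : q ∈ cell h k := by
    intro i
    fin_cases i
    exacts [ht₀, ht₁]
  -- The values at `q` of the two affine forms. The two root equations are a homogeneous linear
  -- system in them with nonzero determinant, so `q` lies on both lines.
  set g := (t₀ - p 0) * n 0 + (t₁ - p 1) * n 1 with hg
  set g' := (t₀ - p' 0) * n' 0 + (t₁ - p' 1) * n' 1 with hg'
  have e0 : n 1 * g' = n' 1 * g := by
    simp only [hg, hg']; unfold crossing at hr₀; linarith
  have e1 : n 0 * g' = n' 0 * g := by
    simp only [hg, hg']; unfold crossing at hr₁; linarith
  have hg0 : g = 0 := by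
    have : (n 1 * n' 0 - n' 1 * n 0) * g = 0 := by linear_combination n 0 * e0 - n 1 * e1
    exact (mul_eq_zero.1 this).resolve_left hdet
  have hg0' : g' = 0 := by
    rw [hg0, mul_zero] at e0
    exact (mul_eq_zero.1 e0).resolve_left fun hc => by simp [hc] at h1
  have hcone (r ν : Plane) (hr : (t₀ - r 0) * ν 0 + (t₁ - r 1) * ν 1 = 0) (z : Plane) :
      AffineMap.homothety q (2 : ℝ) z ∈ halfPlane r ν ↔ z ∈ halfPlane r ν := by
    rw [mem_halfPlane_iff zero_ne_one, mem_halfPlane_iff zero_ne_one]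
    have c (i : Fin 2) : AffineMap.homothety q (2 : ℝ) z i = 2 * z i - q i := by
      simp only [AffineMap.homothety_apply, vsub_eq_sub, vadd_eq_add, PiLp.add_apply,
        PiLp.smul_apply, PiLp.sub_apply, smul_eq_mul]
      ring
    rw [c, c, hq0, hq1]
    constructor <;> intro _ <;> linarith
  set A := halfPlane p n
  set B := halfPlane p' n'
  -- Any other stencil cell lies to one side of the central strip in some coordinate, and the lines
  -- have crossed inside that strip.
  have hnest (j : Fin 2 → ℤ) (hj : j ∈ (stencil k).erase k) : NestedOn (cell h j) A B := by
    obtain ⟨hjk, hj⟩ := Finset.mem_erase.1 hj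
    obtain ⟨i, hi⟩ := Function.ne_iff.1 hjk
    have hlr : (∀ z ∈ cell h j, z i ≤ h * k i) ∨ (∀ z ∈ cell h j, h * (k i + 1) ≤ z i) := by
      rcases mem_stencil.1 hj i with h2 | h2 | h2
      · left; intro z hz
        have := (hz i).2
        rw [h2] at this
        simpa using this
      · exact absurd h2 hi
      · right; intro z hz
        have := (hz i).1
        rw [h2] at this
        simpa using this
    fin_cases i
    · exact hlr.elim (hl₀ _) (hu₀ _)
    · exact hlr.elim (hl₁ _) (hu₁ _)
  have himg : AffineMap.homothety q (2 : ℝ) '' (cell h k ∩ symmDiff A B) ⊆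
      ⋃ j ∈ stencil k, cell h j ∩ symmDiff A B := by
    rintro _ ⟨z, ⟨hz, hzA⟩, rfl⟩
    obtain ⟨j, hj, hzj⟩ := exists_mem_stencil_cell (k := k)
      (z := AffineMap.homothety q (2 : ℝ) z) fun i => by
        have a := hz i
        have b := hqc i
        simp only [AffineMap.homothety_apply, vsub_eq_sub, vadd_eq_add, PiLp.add_apply,
          PiLp.smul_apply, PiLp.sub_apply, smul_eq_mul]
        constructor <;> linarith
    refine Set.mem_iUnion₂.2 ⟨j, hj, hzj, ?_⟩
    rw [Set.mem_symmDiff, hcone p n hg0, hcone p' n' hg0']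
    exact hzA
  -- Dilation by 2 multiplies area by 2². One of the four copies is absorbed by the central cell,
  -- leaving three times the central area bounded by the outer cells.
  have h4 : 4 * volume.real (cell h k ∩ symmDiff A B) ≤
      ∑ j ∈ stencil k, volume.real (cell h j ∩ symmDiff A B) := by
    have hv := Measure.addHaar_image_homothety (volume : Measure Plane) q 2
      (cell h k ∩ symmDiff A B)
    have hv' : volume.real (AffineMap.homothety q (2 : ℝ) '' (cell h k ∩ symmDiff A B)) =
        4 * volume.real (cell h k ∩ symmDiff A B) := by
      rw [measureReal_def, hv, ENNReal.toReal_mul, finrank_euclideanSpace_fin,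
        ENNReal.toReal_ofReal (abs_nonneg _), ← measureReal_def]
      norm_num
    rw [← hv']
    refine (measureReal_mono himg ?_).trans (measureReal_biUnion_finset_le _ _)
    exact ((measure_biUnion_finset_le _ _).trans_lt
      (ENNReal.sum_lt_top.2 fun j _ => (volume_cell_inter_ne_top h j _).lt_top)).ne
  have hsplit (f : (Fin 2 → ℤ) → ℝ) : ∑ j ∈ stencil k, f j = f k + ∑ j ∈ (stencil k).erase k, f j :=
    (Finset.add_sum_erase _ f (self_mem_stencil k)).symm
  rw [hsplit] at h4 ⊢
  have hring : ∑ j ∈ (stencil k).erase k, volume.real (cell h j ∩ symmDiff A B) =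
      ∑ j ∈ (stencil k).erase k, areaGap h j A B :=
    Finset.sum_congr rfl fun j hj => (hnest j hj).volume_real_cell_inter
  have := areaGap_nonneg h k A B
  have : 0 ≤ volume.real (cell h k ∩ symmDiff A B) := measureReal_nonneg
  linarith

/-- Two half-planes whose boundary lines meet a cell are, on this cell, at an `L¹` distance controlled
by the differences of their areas in the cells of the stencil. -/
theorem inverse_inequality {h : ℝ} (hh : 0 < h) {k : Fin 2 → ℤ} {p n p' n' : Plane}
    (hp : p ∈ cell h k) (hp' : p' ∈ cell h k) (hn' : n' ≠ 0) :
    volume.real (cell h k ∩ symmDiff (halfPlane p n) (halfPlane p' n')) ≤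
      ∑ j ∈ stencil k, areaGap h j (halfPlane p n) (halfPlane p' n') := by
  rcases le_or_gt (n 0 * n' 0) 0 with h0 | h0 <;> rcases le_or_gt (n 1 * n' 1) 0 with h1 | h1
  · exact inverse_inequality_of_opposite hh hp hp' hn' h0 h1
  · exact inverse_inequality_of_mixed hh zero_ne_one h0 h1
  · exact inverse_inequality_of_mixed hh one_ne_zero h1 h0
  · exact inverse_inequality_of_same h0 h1

/-! ### Area of strips -/

/-- In an orthonormal frame starting with `n`, the set lies in a rectangle with sides 2δ and 2ρ. -/
theorem volume_strip_le (z₀ : Plane) {n : Plane} (hn : ‖n‖ = 1) {ρ δ : ℝ} (hδ : 0 ≤ δ) :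
    volume {z | ‖z - z₀‖ ≤ ρ ∧ |inner ℝ (z - z₀) n| ≤ δ} ≤ ENNReal.ofReal (4 * ρ * δ) := by
  obtain ⟨b, hb⟩ := Orthonormal.exists_orthonormalBasis_extension_of_card_eq (𝕜 := ℝ)
    (E := Plane) (ι := Fin 2) (by simp) (v := fun _ => n) (s := {0})
    (by
      refine ⟨fun _ => hn, fun i j hij => absurd (Subsingleton.elim i j) hij⟩)
  have hb0 : b 0 = n := hb 0 rfl
  have hm : MeasurePreserving (fun z : Plane => WithLp.ofLp (b.repr (z - z₀))) volume volume :=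
    (PiLp.volume_preserving_ofLp (Fin 2)).comp
      (b.measurePreserving_repr.comp (measurePreserving_sub_right volume z₀))
  have hsub : {z : Plane | ‖z - z₀‖ ≤ ρ ∧ |inner ℝ (z - z₀) n| ≤ δ} ⊆
      (fun z : Plane => WithLp.ofLp (b.repr (z - z₀))) ⁻¹' Set.Icc ![-δ, -ρ] ![δ, ρ] := by
    rintro z ⟨h1, h2⟩
    have e0 : b.repr (z - z₀) 0 = inner ℝ (z - z₀) n := by
      rw [b.repr_apply_apply, hb0, real_inner_comm]
    have e1 : |b.repr (z - z₀) 1| ≤ ρ := by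
      rw [b.repr_apply_apply]
      refine (abs_real_inner_le_norm _ _).trans ?_
      rwa [b.orthonormal.1, one_mul]
    rw [← e0] at h2
    rw [abs_le] at h2 e1
    refine ⟨fun i => ?_, fun i => ?_⟩ <;> fin_cases i
    exacts [h2.1, e1.1, h2.2, e1.2]
  refine (measure_mono hsub).trans ?_
  rw [hm.measure_preimage measurableSet_Icc.nullMeasurableSet, Real.volume_Icc_pi,
    Fin.prod_univ_two]
  simp only [Matrix.cons_val_zero, Matrix.cons_val_one]
  rw [← ENNReal.ofReal_mul (by linarith)]
  exact ENNReal.ofReal_le_ofReal (by linarith)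

theorem volume_line (p : Plane) {n : Plane} (hn : ‖n‖ = 1) :
    volume {z | inner ℝ (z - p) n = 0} = 0 := by
  have h (N : ℕ) : volume {z : Plane | ‖z - p‖ ≤ N ∧ |inner ℝ (z - p) n| ≤ 0} = 0 := by
    simpa using volume_strip_le p hn (ρ := N) le_rfl
  refine measure_mono_null (fun z hz => ?_) (measure_iUnion_null h)
  obtain ⟨N, hN⟩ := exists_nat_ge ‖z - p‖
  refine Set.mem_iUnion.2 ⟨N, hN, ?_⟩
  rw [show inner ℝ (z - p) n = 0 from hz, abs_zero]

/-! ### Linear interfaces -/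

/-- The angle is the argument of the complex number `n 1 - i n 0`. -/
theorem exists_normal_eq {n : Plane} (hn : ‖n‖ = 1) : ∃ θ, normal θ = n := by
  have h1 : n 0 ^ 2 + n 1 ^ 2 = 1 := by
    have := EuclideanSpace.norm_sq_eq n
    simp only [hn, Fin.sum_univ_two, Real.norm_eq_abs, sq_abs] at this
    linarith
  have hc : ‖(⟨n 1, -n 0⟩ : ℂ)‖ = 1 := by
    rw [← sq_eq_sq₀ (norm_nonneg _) zero_le_one, Complex.sq_norm, Complex.normSq_mk]
    linarith
  refine ⟨Complex.arg ⟨n 1, -n 0⟩, ?_⟩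
  have hcos := Complex.norm_mul_cos_arg ⟨n 1, -n 0⟩
  have hsin := Complex.norm_mul_sin_arg ⟨n 1, -n 0⟩
  rw [hc, one_mul] at hcos hsin
  ext i
  fin_cases i
  · simp [normal, hsin]
  · simp [normal, hcos]

theorem norm_normal (θ : ℝ) : ‖normal θ‖ = 1 := by
  rw [← sq_eq_sq₀ (norm_nonneg _) zero_le_one, EuclideanSpace.norm_sq_eq]
  simp [normal, Fin.sum_univ_two]

/-- Replacing the offset by a point of the line inside the cell makes the parameter space the
compact product of the cell and the unit circle. -/
theorem mem_linearInterfaces {h : ℝ} {k : Fin 2 → ℤ} {v : Plane → ℝ} :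
    v ∈ linearInterfaces h k ↔ ∃ p ∈ cell h k, ∃ n : Plane, ‖n‖ = 1 ∧ v = chi (halfPlane p n) := by
  have key (p n : Plane) : {z | inner ℝ (z - cellCenter h k) n ≤ inner ℝ (p - cellCenter h k) n} =
      halfPlane p n := by
    ext z
    simp only [halfPlane, Set.mem_ofPred_eq, inner_sub_left]
    constructor <;> intro _ <;> linarith
  constructor
  · rintro ⟨r, θ, ⟨p, hp, rfl⟩, rfl⟩
    exact ⟨p, hp, normal θ, norm_normal θ, by rw [key]⟩
  · rintro ⟨p, hp, n, hn, rfl⟩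
    obtain ⟨θ, rfl⟩ := exists_normal_eq hn
    exact ⟨_, θ, ⟨p, hp, rfl⟩, by rw [key]⟩

theorem chi_of_mem {A : Set Plane} {z : Plane} (hz : z ∈ A) : chi A z = 1 := by
  rw [chi, Set.indicator_of_mem hz, Pi.one_apply]

theorem chi_of_notMem {A : Set Plane} {z : Plane} (hz : z ∉ A) : chi A z = 0 := by
  rw [chi, Set.indicator_of_notMem hz]

theorem cellAverage_chi {h : ℝ} (hh : 0 < h) (k : Fin 2 → ℤ) {A : Set Plane}
    (hA : MeasurableSet A) : cellAverage h k (chi A) = volume.real (cell h k ∩ A) / h ^ 2 := by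
  rw [cellAverage, setAverage_eq, volume_real_cell hh.le, smul_eq_mul, chi,
    integral_indicator_one hA, measureReal_restrict_apply hA, Set.inter_comm, div_eq_inv_mul]

/-! ### Existence of a recovery -/

/-- Dominated convergence: off the boundary line, a null set, the characteristic function is locally
constant in the parameters. -/
theorem continuousAt_cellAverage_halfPlane {h : ℝ} (k : Fin 2 → ℤ) {x : Plane × Plane}
    (hx : ‖x.2‖ = 1) :
    ContinuousAt (fun y : Plane × Plane => cellAverage h k (chi (halfPlane y.1 y.2))) x := by
  simp only [cellAverage, setAverage_eq, smul_eq_mul]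
  suffices hint : ContinuousAt
      (fun y : Plane × Plane => ∫ z in cell h k, chi (halfPlane y.1 y.2) z) x from
    hint.const_mul _
  refine continuousAt_of_dominated (bound := fun _ => 1) ?_ ?_ ?_ ?_
  · refine .of_forall fun y => ?_
    exact (measurable_one.indicator (measurableSet_halfPlane y.1 y.2)).aestronglyMeasurable
  · refine .of_forall fun y => .of_forall fun z => ?_
    exact (norm_indicator_le_norm_self _ _).trans (by simp)
  · exact integrableOn_const (volume_cell_ne_top h k)
  · refine ae_restrict_of_ae ?_
    have hline : ∀ᵐ z : Plane, inner ℝ (z - x.1) x.2 ≠ 0 := by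
      rw [ae_iff]
      simpa using volume_line x.1 hx
    filter_upwards [hline] with z hz
    have hc : Continuous fun y : Plane × Plane => inner ℝ (z - y.1) y.2 := by fun_prop
    rcases lt_or_gt_of_ne hz with hz | hz
    · refine continuousAt_const (y := (1 : ℝ)) |>.congr ?_
      filter_upwards [hc.continuousAt.eventually_lt continuousAt_const hz] with y hy
      exact (chi_of_mem (show z ∈ halfPlane y.1 y.2 from le_of_lt hy)).symm
    · refine continuousAt_const (y := (0 : ℝ)) |>.congr ?_
      filter_upwards [continuousAt_const.eventually_lt hc.continuousAt hz] with y hy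
      exact (chi_of_notMem (show z ∉ halfPlane y.1 y.2 from not_le_of_gt hy)).symm

theorem cellCenter_mem_cell {h : ℝ} (hh : 0 < h) (k : Fin 2 → ℤ) : cellCenter h k ∈ cell h k := by
  intro i
  simp only [cellCenter]
  constructor <;> nlinarith

theorem exists_isMinOn_loss {h : ℝ} (hh : 0 < h) (k : Fin 2 → ℤ) (u : Plane → ℝ) :
    ∃ w ∈ linearInterfaces h k, IsMinOn (loss h k u) (linearInterfaces h k) w := by
  have hK : IsCompact (cell h k ×ˢ Metric.sphere (0 : Plane) 1) :=
    (isCompact_cell h k).prod (isCompact_sphere _ _)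
  have hne : (cell h k ×ˢ Metric.sphere (0 : Plane) 1).Nonempty :=
    ⟨(cellCenter h k, normal 0), cellCenter_mem_cell hh k, by simp [norm_normal]⟩
  have hcont : ContinuousOn (fun y : Plane × Plane => loss h k u (chi (halfPlane y.1 y.2)))
      (cell h k ×ˢ Metric.sphere (0 : Plane) 1) := by
    refine continuousOn_of_forall_continuousAt fun x hx => ?_
    have hx2 : ‖x.2‖ = 1 := by simpa using hx.2
    have hj (j : Fin 2 → ℤ) : ContinuousAt (fun y : Plane × Plane =>
        (cellAverage h j u - cellAverage h j (chi (halfPlane y.1 y.2))) ^ 2) x :=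
      (continuousAt_const.sub (continuousAt_cellAverage_halfPlane j hx2)).pow 2
    simp only [loss]
    exact tendsto_finsetSum _ fun j _ => hj j
  obtain ⟨x, hx, hmin⟩ := hK.exists_isMinOn hne hcont
  have hx2 : ‖x.2‖ = 1 := by simpa using hx.2
  refine ⟨chi (halfPlane x.1 x.2), mem_linearInterfaces.2 ⟨x.1, hx.1, x.2, hx2, rfl⟩, ?_⟩
  refine isMinOn_iff.2 fun v hv => ?_
  obtain ⟨p, hp, n, hn, rfl⟩ := mem_linearInterfaces.1 hv
  have hmem : (p, n) ∈ cell h k ×ˢ Metric.sphere (0 : Plane) 1 :=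
    Set.mk_mem_prod hp (mem_sphere_zero_iff_norm.2 hn)
  exact isMinOn_iff.1 hmin (p, n) hmem

theorem exists_isLocalRecovery {h : ℝ} (hh : 0 < h) (k : Fin 2 → ℤ) (Ω : Set Plane) :
    ∃ w, IsLocalRecovery h k Ω w := by
  by_cases hs : IsSingular h k Ω
  · obtain ⟨w, hw, hmin⟩ := exists_isMinOn_loss hh k (chi Ω)
    exact ⟨w, fun _ => ⟨hw, hmin⟩, fun hc => absurd hs hc⟩
  · exact ⟨_, fun hc => absurd hc hs, fun _ => rfl⟩

theorem exists_isReconstruction {l : ℕ} (hl : 0 < l) (Ω : Set Plane) :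
    ∃ u', IsReconstruction l Ω u' := by
  have hh : 0 < 1 / (l : ℝ) := by positivity
  choose w hw using fun k => exists_isLocalRecovery hh k Ω
  exact ⟨_, w, fun k _ => hw k, rfl⟩

/-! ### Near-optimality of a recovery -/

theorem volume_real_symmDiff_triangle {S A B C : Set Plane} (hS : volume S ≠ ⊤) :
    volume.real (S ∩ symmDiff A C) ≤
      volume.real (S ∩ symmDiff A B) + volume.real (S ∩ symmDiff B C) := by
  refine (measureReal_mono ?_ ?_).trans (measureReal_union_le _ _)
  · rw [← Set.inter_union_distrib_left]
    exact Set.inter_subset_inter_right S (symmDiff_triangle A B C)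
  · rw [← Set.inter_union_distrib_left]
    exact measure_ne_top_of_subset Set.inter_subset_left hS

theorem abs_volume_real_sub_le {S A B : Set Plane} (hS : volume S ≠ ⊤) :
    |volume.real (S ∩ A) - volume.real (S ∩ B)| ≤ volume.real (S ∩ symmDiff A B) := by
  have h (A B : Set Plane) :
      volume.real (S ∩ A) ≤ volume.real (S ∩ B) + volume.real (S ∩ symmDiff A B) := by
    refine (measureReal_mono ?_ ?_).trans (measureReal_union_le _ _)
    · rw [← Set.inter_union_distrib_left]
      refine Set.inter_subset_inter_right S fun z hz => ?_
      by_cases hB : z ∈ B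
      · exact .inl hB
      · exact .inr (.inl ⟨hz, hB⟩)
    · rw [← Set.inter_union_distrib_left]
      exact measure_ne_top_of_subset Set.inter_subset_left hS
  rw [abs_le]
  have h1 := h A B
  have h2 := h B A
  rw [symmDiff_comm] at h2
  constructor <;> linarith

/-- On a cell, the error of a minimizer of the loss is controlled by the error on the stencil of an
arbitrary admissible half-plane. -/
theorem volume_real_symmDiff_minimizer_le {h : ℝ} (hh : 0 < h) {k : Fin 2 → ℤ} {Ω : Set Plane}
    (hΩ : MeasurableSet Ω) {p n p' n' : Plane} (hp : p ∈ cell h k)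
    (hp' : p' ∈ cell h k) (hn' : ‖n'‖ = 1)
    (hmin : loss h k (chi Ω) (chi (halfPlane p' n')) ≤ loss h k (chi Ω) (chi (halfPlane p n)))
    {ε : ℝ} (hε : ∀ j ∈ stencil k, volume.real (cell h j ∩ symmDiff Ω (halfPlane p n)) ≤ ε) :
    volume.real (cell h k ∩ symmDiff Ω (halfPlane p' n')) ≤ 37 * ε := by
  set A := halfPlane p n with hA
  set B := halfPlane p' n' with hB
  have hε0 : 0 ≤ ε := measureReal_nonneg.trans (hε k (self_mem_stencil k))
  have hloss (q ν : Plane) : h ^ 4 * loss h k (chi Ω) (chi (halfPlane q ν)) =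
      ∑ j ∈ stencil k, areaGap h j Ω (halfPlane q ν) ^ 2 := by
    rw [loss, Finset.mul_sum]
    refine Finset.sum_congr rfl fun j _ => ?_
    rw [cellAverage_chi hh j hΩ, cellAverage_chi hh j (measurableSet_halfPlane q ν), areaGap,
      sq_abs]
    field_simp
  have hgapA (j : Fin 2 → ℤ) (hj : j ∈ stencil k) : areaGap h j Ω A ≤ ε :=
    (abs_volume_real_sub_le (volume_cell_ne_top h j)).trans (hε j hj)
  have hsumA : ∑ j ∈ stencil k, areaGap h j Ω A ^ 2 ≤ 9 * ε ^ 2 := by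
    have := Finset.sum_le_card_nsmul (stencil k) (fun j => areaGap h j Ω A ^ 2) (ε ^ 2)
      fun j hj => pow_le_pow_left₀ (areaGap_nonneg _ _ _ _) (hgapA j hj) 2
    simpa [card_stencil] using this
  have hsumB : ∑ j ∈ stencil k, areaGap h j Ω B ^ 2 ≤ 9 * ε ^ 2 := by
    refine le_trans ?_ hsumA
    rw [← hloss, ← hloss]
    exact mul_le_mul_of_nonneg_left hmin (by positivity)
  -- Each squared gap is at most the sum of the nine, hence at most 9ε².
  have hgapB (j : Fin 2 → ℤ) (hj : j ∈ stencil k) : areaGap h j Ω B ≤ 3 * ε := by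
    have h1 : areaGap h j Ω B ^ 2 ≤ (3 * ε) ^ 2 := by
      refine (Finset.single_le_sum (f := fun j => areaGap h j Ω B ^ 2)
        (fun _ _ => sq_nonneg _) hj).trans (hsumB.trans_eq (by ring))
    exact le_of_sq_le_sq h1 (by positivity)
  have hgap (j : Fin 2 → ℤ) (hj : j ∈ stencil k) : areaGap h j A B ≤ 4 * ε := by
    have h1 := hgapA j hj
    have h2 := hgapB j hj
    have h3 : areaGap h j A B ≤ areaGap h j Ω A + areaGap h j Ω B := by
      unfold areaGap
      rw [abs_sub_comm (volume.real (cell h j ∩ Ω)) (volume.real (cell h j ∩ A))]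
      exact abs_sub_le _ _ _
    linarith
  -- 36 = 9 · 4: nine stencil cells, each with gap at most ε + 3ε. The final 37 adds the distance ε
  -- from Ω to the competitor on the cell itself.
  have hinv : volume.real (cell h k ∩ symmDiff A B) ≤ 36 * ε := by
    refine (inverse_inequality hh hp hp' (by rintro rfl; simp at hn')).trans ?_
    refine (Finset.sum_le_card_nsmul _ _ _ hgap).trans_eq ?_
    rw [card_stencil, nsmul_eq_mul]
    push_cast
    ring
  have htri := volume_real_symmDiff_triangle (A := Ω) (B := A) (C := B) (volume_cell_ne_top h k)
  linarith [hε k (self_mem_stencil k)]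

/-! ### Regularity of the boundary -/

theorem abs_sub_le_of_abs_derivWithin_le {R C : ℝ} {ψ : ℝ → ℝ}
    (hd : DifferentiableOn ℝ ψ (Set.Icc (-R) R))
    (hC : ∀ x ∈ Set.Icc (-R) R, |derivWithin ψ (Set.Icc (-R) R) x| ≤ C)
    {x y : ℝ} (hx : x ∈ Set.Icc (-R) R) (hy : y ∈ Set.Icc (-R) R) :
    |ψ x - ψ y| ≤ C * |x - y| :=
  Convex.norm_image_sub_le_of_norm_derivWithin_le hd hC (convex_Icc _ _) hy hx

/-- A function whose derivative differs at `x` from that at `0` by at most `M |x| ^ β` is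
approximated to order `1 + β` by its tangent at `0`. -/
theorem abs_sub_tangent_le {R M β : ℝ} (hβ : 0 ≤ β) (hM : 0 ≤ M) {ψ : ℝ → ℝ}
    (hd : DifferentiableOn ℝ ψ (Set.Icc (-R) R))
    (hC : ∀ x ∈ Set.Icc (-R) R, |derivWithin ψ (Set.Icc (-R) R) x -
      derivWithin ψ (Set.Icc (-R) R) 0| ≤ M * |x| ^ β)
    {x : ℝ} (hx : x ∈ Set.Icc (-R) R) :
    |ψ x - ψ 0 - derivWithin ψ (Set.Icc (-R) R) 0 * x| ≤ M * |x| ^ (1 + β) := by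
  set m := derivWithin ψ (Set.Icc (-R) R) 0
  have hsub : Set.Icc (-|x|) |x| ⊆ Set.Icc (-R) R := by
    have : |x| ≤ R := abs_le.2 hx
    exact Set.Icc_subset_Icc (by linarith) this
  have hder : ∀ y ∈ Set.Icc (-|x|) |x|, HasDerivWithinAt (fun t => ψ t - m * t)
      (derivWithin ψ (Set.Icc (-R) R) y - m) (Set.Icc (-|x|) |x|) y := fun y hy => by
    have h1 := ((hd y (hsub hy)).hasDerivWithinAt).mono hsub
    have h2 : HasDerivWithinAt (fun t : ℝ => m * t) m (Set.Icc (-|x|) |x|) y := by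
      simpa using (hasDerivWithinAt_id y (Set.Icc (-|x|) |x|)).const_mul m
    exact h1.sub h2
  have hbd : ∀ y ∈ Set.Icc (-|x|) |x|, ‖derivWithin ψ (Set.Icc (-R) R) y - m‖ ≤ M * |x| ^ β :=
    fun y hy => (hC y (hsub hy)).trans <| mul_le_mul_of_nonneg_left
      (Real.rpow_le_rpow (abs_nonneg y) (abs_le.2 hy) hβ) hM
  have h := Convex.norm_image_sub_le_of_norm_hasDerivWithin_le hder hbd (convex_Icc _ _)
    (x := 0) (y := x) (by simp) (abs_le.1 le_rfl)
  simp only [Real.norm_eq_abs, sub_zero, mul_zero] at h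
  calc |ψ x - ψ 0 - m * x| = |ψ x - m * x - ψ 0| := by ring_nf
    _ ≤ M * |x| ^ β * |x| := h
    _ = M * |x| ^ (1 + β) := by
      rw [Real.rpow_add_of_nonneg (abs_nonneg x) zero_le_one hβ, Real.rpow_one]; ring

theorem HolderNormLE.bounds {s R M : ℝ} (hR : 0 < R) {ψ : ℝ → ℝ} (h : HolderNormLE s R M ψ) :
    (∀ j ≤ ⌈s⌉₊ - 1, ∀ x ∈ Set.Icc (-R) R,
      |iteratedDerivWithin j ψ (Set.Icc (-R) R) x| ≤ M) ∧
    (∀ x ∈ Set.Icc (-R) R, ∀ y ∈ Set.Icc (-R) R,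
      |iteratedDerivWithin (⌈s⌉₊ - 1) ψ (Set.Icc (-R) R) x
          - iteratedDerivWithin (⌈s⌉₊ - 1) ψ (Set.Icc (-R) R) y|
        ≤ M * |x - y| ^ (s - ((⌈s⌉₊ - 1 : ℕ) : ℝ))) := by
  obtain ⟨-, A, B, hAB, hA, hB⟩ := h
  have hA0 : 0 ≤ A := (abs_nonneg _).trans (hA 0 (Nat.zero_le _) 0 ⟨by linarith, hR.le⟩)
  -- Nonnegativity of the seminorm bound is read off from the pair R, -R, at positive distance.
  have hB0 : 0 ≤ B := by
    have h1 := (abs_nonneg _).trans (hB R ⟨by linarith, le_rfl⟩ (-R) ⟨le_rfl, by linarith⟩)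
    have h2 : 0 < |R - -R| ^ (s - ((⌈s⌉₊ - 1 : ℕ) : ℝ)) :=
      Real.rpow_pos_of_pos (abs_pos.2 (by linarith)) _
    exact nonneg_of_mul_nonneg_left h1 h2
  refine ⟨fun j hj x hx => (hA j hj x hx).trans (by linarith), fun x hx y hy =>
    (hB x hx y hy).trans (mul_le_mul_of_nonneg_right (by linarith) (by positivity))⟩

/-- For s = 1 the Hölder clause, with n = 0 and α = 1, is the Lipschitz bound itself; for s > 1 the
first derivative is bounded. -/
theorem HolderNormLE.lipschitz {s R M : ℝ} (hs : 1 ≤ s) (hR : 0 < R) {ψ : ℝ → ℝ}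
    (h : HolderNormLE s R M ψ) {x y : ℝ} (hx : x ∈ Set.Icc (-R) R) (hy : y ∈ Set.Icc (-R) R) :
    |ψ x - ψ y| ≤ M * |x - y| := by
  obtain ⟨h1, h2⟩ := h.bounds hR
  rcases hs.eq_or_lt with rfl | hs
  · simpa using h2 x hx y hy
  · have hceil : 1 < ⌈s⌉₊ := Nat.lt_ceil.2 (by simpa using hs)
    have hn : 1 ≤ ⌈s⌉₊ - 1 := by omega
    refine abs_sub_le_of_abs_derivWithin_le (h.1.differentiableOn ?_) ?_ hx hy
    · exact_mod_cast (by omega : ⌈s⌉₊ - 1 ≠ 0)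
    · simpa [iteratedDerivWithin_one] using h1 1 hn

/-- Three regimes: for s = 1 the slope 0 and the Lipschitz bound suffice; for 1 < s ≤ 2 the
derivative is (s - 1)-Hölder; for s > 2 it is Lipschitz because the second derivative is bounded,
and the order saturates at 2. -/
theorem HolderNormLE.exists_tangent {s R M : ℝ} (hs : 1 ≤ s) (hR : 0 < R) (hM : 0 ≤ M) {ψ : ℝ → ℝ}
    (h : HolderNormLE s R M ψ) :
    ∃ m : ℝ, ∀ x ∈ Set.Icc (-R) R, |ψ x - ψ 0 - m * x| ≤ M * |x| ^ min s 2 := by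
  have h0 : (0 : ℝ) ∈ Set.Icc (-R) R := ⟨by linarith, hR.le⟩
  rcases hs.eq_or_lt with rfl | hs1
  · refine ⟨0, fun x hx => ?_⟩
    simpa using h.lipschitz le_rfl hR hx h0
  obtain ⟨h1, h2⟩ := h.bounds hR
  have hceil : 1 < ⌈s⌉₊ := Nat.lt_ceil.2 (by simpa using hs1)
  have hd : DifferentiableOn ℝ ψ (Set.Icc (-R) R) :=
    h.1.differentiableOn (by exact_mod_cast (by omega : ⌈s⌉₊ - 1 ≠ 0))
  refine ⟨derivWithin ψ (Set.Icc (-R) R) 0, fun x hx => ?_⟩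
  rcases le_or_gt s 2 with hs2 | hs2
  · have hc2 : ⌈s⌉₊ - 1 = 1 := by
      have : ⌈s⌉₊ ≤ 2 := Nat.ceil_le.2 (by simpa using hs2)
      omega
    rw [hc2] at h2
    have h3 := abs_sub_tangent_le (β := s - 1) (by linarith) hM hd (fun y hy => by
      simpa [iteratedDerivWithin_one] using h2 y hy 0 h0) hx
    rwa [add_sub_cancel, ← min_eq_left hs2] at h3
  · have hc2 : 2 < ⌈s⌉₊ := Nat.lt_ceil.2 (by simpa using hs2)
    have hn : 2 ≤ ⌈s⌉₊ - 1 := by omega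
    have hd' : DifferentiableOn ℝ (derivWithin ψ (Set.Icc (-R) R)) (Set.Icc (-R) R) := by
      rw [← iteratedDerivWithin_one]
      exact h.1.differentiableOn_iteratedDerivWithin (by exact_mod_cast hn)
        (uniqueDiffOn_Icc (by linarith))
    have hb : ∀ y ∈ Set.Icc (-R) R,
        |derivWithin (derivWithin ψ (Set.Icc (-R) R)) (Set.Icc (-R) R) y| ≤ M := by
      intro y hy
      have := h1 2 hn y hy
      rwa [iteratedDerivWithin_succ, iteratedDerivWithin_one] at this
    have h3 := abs_sub_tangent_le (β := 1) zero_le_one hM hd (fun y hy => by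
      simpa using abs_sub_le_of_abs_derivWithin_le hd' hb hy h0) hx
    rw [min_eq_right hs2.le]
    norm_num at h3 ⊢
    exact h3

/-- The local description of a domain of class `C^s` near a boundary point, in the coordinates
given by an orthonormal basis. -/
structure IsLocalGraph (s R M : ℝ) (Ω : Set Plane) (z₀ : Plane)
    (e : OrthonormalBasis (Fin 2) ℝ Plane) (ψ : ℝ → ℝ) : Prop where
  holder : HolderNormLE s R M ψ
  mem_iff : ∀ z : Plane, ‖z - z₀‖ ≤ R →
    (z ∈ Ω ↔ inner ℝ (e 1) (z - z₀) ≤ ψ (inner ℝ (e 0) (z - z₀)))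

/-- As P > 1, the ball of radius R fits in the coordinate box of the chart. -/
theorem IsClassC.exists_isLocalGraph {s : ℝ} {Ω : Set Plane} (hΩ : IsClassC s Ω) :
    ∃ R M : ℝ, 0 < R ∧ 0 < M ∧ ∀ z₀ ∈ frontier Ω, ∃ e ψ, IsLocalGraph s R M Ω z₀ e ψ := by
  obtain ⟨R, P, M, hR, hP, hM, h⟩ := hΩ
  refine ⟨R, M, hR, hM, fun z₀ hz₀ => ?_⟩
  obtain ⟨e, ψ, hψ, -, hmem⟩ := h z₀ hz₀
  refine ⟨e, ψ, hψ, fun z hz => ?_⟩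
  have hb (i : Fin 2) : |inner ℝ (e i) (z - z₀)| ≤ R := by
    refine (abs_real_inner_le_norm _ _).trans ?_
    rwa [e.orthonormal.1, one_mul]
  have hz' : z = z₀ + (inner ℝ (e 0) (z - z₀) : ℝ) • e 0 + (inner ℝ (e 1) (z - z₀) : ℝ) • e 1 := by
    have := e.sum_repr' (z - z₀)
    rw [Fin.sum_univ_two] at this
    rw [add_assoc, this]
    abel
  have := hmem _ _ (hb 0) ((hb 1).trans (le_mul_of_one_le_left hR.le hP.le))
  rwa [← hz'] at this

theorem abs_inner_orthonormalBasis_le (e : OrthonormalBasis (Fin 2) ℝ Plane) (i : Fin 2)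
    (z : Plane) : |inner ℝ (e i) z| ≤ ‖z‖ := by
  refine (abs_real_inner_le_norm _ _).trans ?_
  rw [e.orthonormal.1, one_mul]

namespace IsLocalGraph

variable {s R M : ℝ} {Ω : Set Plane} {z₀ : Plane} {e : OrthonormalBasis (Fin 2) ℝ Plane}
  {ψ : ℝ → ℝ}

/-- Near the base point, the frontier is contained in the graph. -/
theorem eq_of_mem_frontier (h : IsLocalGraph s R M Ω z₀ e ψ) (hs : 1 ≤ s) (hR : 0 < R)
    {z : Plane} (hz : z ∈ frontier Ω) (hzR : ‖z - z₀‖ < R) :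
    inner ℝ (e 1) (z - z₀) = ψ (inner ℝ (e 0) (z - z₀)) := by
  have hcoord (y : Plane) (hy : ‖y - z₀‖ < R) : inner ℝ (e 0) (y - z₀) ∈ Set.Icc (-R) R :=
    abs_le.1 ((abs_inner_orthonormalBasis_le e 0 _).trans hy.le)
  have hball : Metric.ball z₀ R ∈ nhds z :=
    Metric.isOpen_ball.mem_nhds (by rwa [mem_ball_iff_norm])
  have hcont : ContinuousAt (fun y : Plane => ψ (inner ℝ (e 0) (y - z₀))) z := by
    have hlip : LipschitzOnWith M.toNNReal ψ (Set.Icc (-R) R) :=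
      LipschitzOnWith.of_dist_le_mul fun x hx y hy => by
        rw [Real.dist_eq, Real.dist_eq]
        exact (h.holder.lipschitz hs hR hx hy).trans
          (mul_le_mul_of_nonneg_right (Real.le_coe_toNNReal M) (abs_nonneg _))
    have hc : Continuous fun y : Plane => (inner ℝ (e 0) (y - z₀) : ℝ) := by fun_prop
    have := hlip.continuousOn.comp (s := Metric.ball z₀ R) hc.continuousOn
      fun y hy => hcoord y (mem_ball_iff_norm.1 hy)
    exact this.continuousAt hball
  have hcont1 : ContinuousAt (fun y : Plane => (inner ℝ (e 1) (y - z₀) : ℝ)) z := by fun_prop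
  -- A strict inequality on either side persists nearby, which would put `z` in the interior or in
  -- the exterior of Ω.
  rcases lt_trichotomy (inner ℝ (e 1) (z - z₀)) (ψ (inner ℝ (e 0) (z - z₀))) with hlt | heq | hgt
  · exfalso
    refine hz.2 (mem_interior_iff_mem_nhds.2 ?_)
    filter_upwards [hcont1.eventually_lt hcont hlt, hball] with y hy hyb
    exact (h.mem_iff y (mem_ball_iff_norm.1 hyb).le).2 hy.le
  · exact heq
  · exfalso
    rw [frontier_eq_closure_inter_closure] at hz
    refine (mem_closure_iff_frequently.1 hz.1) ?_
    filter_upwards [hcont.eventually_lt hcont1 hgt, hball] with y hy hyb hyΩ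
    exact absurd ((h.mem_iff y (mem_ball_iff_norm.1 hyb).le).1 hyΩ) (not_le_of_gt hy)

theorem apply_zero (h : IsLocalGraph s R M Ω z₀ e ψ) (hs : 1 ≤ s) (hR : 0 < R)
    (hz : z₀ ∈ frontier Ω) : ψ 0 = 0 := by
  have := h.eq_of_mem_frontier hs hR hz (by simpa using hR)
  simpa using this.symm

theorem mem (h : IsLocalGraph s R M Ω z₀ e ψ) (hs : 1 ≤ s) (hR : 0 < R)
    (hz : z₀ ∈ frontier Ω) : z₀ ∈ Ω := by
  rw [h.mem_iff z₀ (by simpa using hR.le)]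
  simp [h.apply_zero hs hR hz]

/-- The half-plane under the tangent at a boundary point approximates the domain. -/
theorem exists_halfPlane (h : IsLocalGraph s R M Ω z₀ e ψ) (hs : 1 ≤ s) (hR : 0 < R) (hM : 0 < M)
    (hz : z₀ ∈ frontier Ω) :
    ∃ n : Plane, ‖n‖ = 1 ∧ ∀ ρ, 0 ≤ ρ → ρ ≤ R →
      volume.real (Metric.closedBall z₀ ρ ∩ symmDiff Ω (halfPlane z₀ n)) ≤
        4 * M * ρ ^ (1 + min s 2) := by
  obtain ⟨m, hm⟩ := h.holder.exists_tangent hs hR hM.le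
  have hψ0 := h.apply_zero hs hR hz
  set N : ℝ := ‖e 1 - m • e 0‖ with hN
  -- The component along `e 1` is 1. Normalizing therefore only shrinks the width of the strip.
  have hN1 : 1 ≤ N := by
    have h1 : inner ℝ (e 1) (e 1 - m • e 0) = (1 : ℝ) := by
      rw [inner_sub_right, inner_smul_right, e.orthonormal.2 (one_ne_zero : (1 : Fin 2) ≠ 0),
        mul_zero, sub_zero, real_inner_self_eq_norm_sq, e.orthonormal.1]
      norm_num
    have h2 := real_inner_le_norm (e 1) (e 1 - m • e 0)
    rwa [h1, e.orthonormal.1, one_mul] at h2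
  have hN0 : 0 < N := by linarith
  have hn : ‖N⁻¹ • (e 1 - m • e 0)‖ = 1 := by
    rw [norm_smul, ← hN, Real.norm_eq_abs, abs_of_pos (inv_pos.2 hN0), inv_mul_cancel₀ hN0.ne']
  refine ⟨N⁻¹ • (e 1 - m • e 0), hn, fun ρ hρ hρR => ?_⟩
  set n := N⁻¹ • (e 1 - m • e 0) with hn_def
  have hinner (z : Plane) : inner ℝ (z - z₀) n =
      N⁻¹ * (inner ℝ (e 1) (z - z₀) - m * inner ℝ (e 0) (z - z₀)) := by
    rw [hn_def, inner_smul_right, inner_sub_right, inner_smul_right, real_inner_comm,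
      real_inner_comm (z - z₀) (e 0)]
  have hδ : 0 ≤ M * ρ ^ min s 2 := by positivity
  have hsub : Metric.closedBall z₀ ρ ∩ symmDiff Ω (halfPlane z₀ n) ⊆
      {z | ‖z - z₀‖ ≤ ρ ∧ |inner ℝ (z - z₀) n| ≤ M * ρ ^ min s 2} := by
    rintro z ⟨hzρ, hzs⟩
    rw [mem_closedBall_iff_norm] at hzρ
    refine ⟨hzρ, ?_⟩
    set x : ℝ := inner ℝ (e 0) (z - z₀) with hx
    set y : ℝ := inner ℝ (e 1) (z - z₀) with hy
    have hxρ : |x| ≤ ρ := (abs_inner_orthonormalBasis_le e 0 _).trans hzρ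
    have hmx := hm x (abs_le.1 (hxρ.trans hρR))
    rw [hψ0, sub_zero] at hmx
    have hΩ : z ∈ Ω ↔ y ≤ ψ x := h.mem_iff z (hzρ.trans hρR)
    have hH : z ∈ halfPlane z₀ n ↔ y ≤ m * x := by
      rw [halfPlane, Set.mem_ofPred_eq, hinner, mul_nonpos_iff_pos_imp_nonpos]
      constructor
      · intro hc; linarith [hc.1 (inv_pos.2 hN0)]
      · intro hc; exact ⟨fun _ => by linarith, fun _ => (inv_pos.2 hN0).le⟩
    -- A point of the symmetric difference lies between the graph and its tangent.
    have hxy : |y - m * x| ≤ |ψ x - m * x| := by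
      rcases hzs with ⟨h1, h2⟩ | ⟨h1, h2⟩
      · rw [hΩ] at h1
        rw [hH, not_le] at h2
        rw [abs_of_pos (by linarith), abs_of_pos (by linarith)]
        linarith
      · rw [hH] at h1
        rw [hΩ, not_le] at h2
        rw [abs_of_nonpos (by linarith), abs_of_nonpos (by linarith)]
        linarith
    rw [hinner, abs_mul, abs_of_pos (inv_pos.2 hN0)]
    calc N⁻¹ * |y - m * x| ≤ 1 * |y - m * x| :=
          mul_le_mul_of_nonneg_right (inv_le_one_of_one_le₀ hN1) (abs_nonneg _)
      _ ≤ M * |x| ^ min s 2 := by rw [one_mul]; exact hxy.trans hmx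
      _ ≤ M * ρ ^ min s 2 := mul_le_mul_of_nonneg_left
          (Real.rpow_le_rpow (abs_nonneg x) hxρ (by positivity)) hM.le
  have hle := (measure_mono hsub).trans (volume_strip_le z₀ hn hδ)
  refine (ENNReal.toReal_mono ENNReal.ofReal_ne_top hle).trans_eq ?_
  rw [ENNReal.toReal_ofReal (by positivity),
    Real.rpow_add_of_nonneg hρ zero_le_one (by positivity), Real.rpow_one]
  ring

end IsLocalGraph

/-- The charts use a non-strict inequality, so boundary points belong to Ω. This is also the source
of the measurability of Ω. -/
theorem IsClassC.isClosed {s : ℝ} (hs : 1 ≤ s) {Ω : Set Plane} (hΩ : IsClassC s Ω) :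
    IsClosed Ω := by
  obtain ⟨R, M, hR, hM, h⟩ := hΩ.exists_isLocalGraph
  rw [← frontier_subset_iff_isClosed]
  intro z hz
  obtain ⟨e, ψ, hg⟩ := h z hz
  exact hg.mem hs hR hz

/-! ### Counting singular cells -/

/-- Otherwise the interior and the exterior of Ω would disconnect the convex cell. -/
theorem IsSingular.exists_mem_frontier {h : ℝ} {k : Fin 2 → ℤ} {Ω : Set Plane}
    (hs : IsSingular h k Ω) : ∃ z ∈ cell h k, z ∈ frontier Ω := by
  by_contra! hc
  obtain ⟨x, hx⟩ := nonempty_of_measure_ne_zero hs.1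
  obtain ⟨y, hy⟩ := nonempty_of_measure_ne_zero hs.2
  have hint {z : Plane} (hz : z ∈ cell h k) (hzΩ : z ∈ Ω) : z ∈ interior Ω := by
    by_contra hzi
    exact hc z hz ⟨subset_closure hzΩ, hzi⟩
  have hext {z : Plane} (hz : z ∈ cell h k) (hzΩ : z ∉ Ω) : z ∈ (closure Ω)ᶜ := fun hzc =>
    hc z hz ⟨hzc, fun hzi => hzΩ (interior_subset hzi)⟩
  obtain ⟨z, -, hz1, hz2⟩ := (convex_cell h k).isPreconnected (interior Ω) (closure Ω)ᶜ
    isOpen_interior isClosed_closure.isOpen_compl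
    (fun z hz => (em (z ∈ Ω)).imp (hint hz) (hext hz))
    ⟨x, hx.1, hint hx.1 hx.2⟩ ⟨y, hy.1, hext hy.1 hy.2⟩
  exact hz2 (subset_closure (interior_subset hz1))

/-- Indices of cells with points at distance at most L h differ by at most L + 1 in each coordinate,
so they all lie in one box. -/
theorem card_le_of_near {h L : ℝ} (hh : 0 < h) {F : Finset (Fin 2 → ℤ)} {z : (Fin 2 → ℤ) → Plane}
    (hz : ∀ k ∈ F, z k ∈ cell h k) (hd : ∀ k ∈ F, ∀ k' ∈ F, ‖z k - z k'‖ ≤ L * h) :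
    F.card ≤ (2 * ⌈L + 1⌉₊ + 1) ^ 2 := by
  rcases F.eq_empty_or_nonempty with rfl | ⟨k₀, hk₀⟩
  · simp
  set N := ⌈L + 1⌉₊
  have hsub : F ⊆ Finset.Icc (fun i => k₀ i - N) (fun i => k₀ i + N) := by
    intro k hk
    have hle (k k' : Fin 2 → ℤ) (hk : k ∈ F) (hk' : k' ∈ F) (i : Fin 2) : k i ≤ k' i + N := by
      have h1 : |z k i - z k' i| ≤ L * h :=
        (PiLp.norm_apply_le (z k - z k') i).trans (hd k hk k' hk')
      have h2 := (hz k hk i).1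
      have h3 := (hz k' hk' i).2
      have h4 : h * (k i - k' i) ≤ h * (L + 1) := by linarith [(abs_le.1 h1).2]
      have h5 : (k i : ℝ) - k' i ≤ N := (le_of_mul_le_mul_left h4 hh).trans (Nat.le_ceil _)
      have h6 : (k i : ℝ) ≤ ((k' i + N : ℤ) : ℝ) := by push_cast; linarith
      exact_mod_cast h6
    rw [Finset.mem_Icc]
    exact ⟨fun i => by linarith [hle k₀ k hk₀ hk i], fun i => hle k k₀ hk hk₀ i⟩
  refine (Finset.card_le_card hsub).trans_eq ?_
  rw [Pi.card_Icc, Fin.prod_univ_two, Int.card_Icc, Int.card_Icc, sq]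
  congr 1 <;> omega

/-- The number of cells of size `h` which meet the frontier near a given point is `O(1 / h)`. -/
theorem IsLocalGraph.card_le {s R M : ℝ} {Ω : Set Plane} {z₀ : Plane}
    {e : OrthonormalBasis (Fin 2) ℝ Plane} {ψ : ℝ → ℝ} (hg : IsLocalGraph s R M Ω z₀ e ψ)
    (hs : 1 ≤ s) (hR : 0 < R) (hM : 0 < M) {h : ℝ} (hh : 0 < h) (hh1 : h ≤ 1)
    {F : Finset (Fin 2 → ℤ)}
    (hF : ∀ k ∈ F, ∃ z ∈ cell h k, z ∈ frontier Ω ∧ ‖z - z₀‖ < R) :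
    (F.card : ℝ) ≤ (2 * ⌈1 + M + 1⌉₊ + 1) ^ 2 * (2 * R + 2) / h := by
  have hF' (k : Fin 2 → ℤ) : ∃ z, k ∈ F → z ∈ cell h k ∧ z ∈ frontier Ω ∧ ‖z - z₀‖ < R := by
    by_cases hk : k ∈ F
    · obtain ⟨z, h1, h2⟩ := hF k hk
      exact ⟨z, fun _ => ⟨h1, h2⟩⟩
    -- A default point for indices outside `F`.
    · exact ⟨0, fun hc => absurd hc hk⟩
  choose z hz using hF'
  set x : (Fin 2 → ℤ) → ℝ := fun k => inner ℝ (e 0) (z k - z₀) with hx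
  have hxR (k : Fin 2 → ℤ) (hk : k ∈ F) : x k ∈ Set.Icc (-R) R :=
    abs_le.1 ((abs_inner_orthonormalBasis_le e 0 _).trans (hz k hk).2.2.le)
  -- Sort the cells into columns of width h along `e 0`. By the Lipschitz bound, points of one
  -- column are within (1 + M) h of each other, so each column holds boundedly many cells.
  have hmaps : ∀ k ∈ F, ⌊x k / h⌋ ∈ Finset.Icc ⌊-R / h⌋ ⌊R / h⌋ := fun k hk => by
    rw [Finset.mem_Icc]
    exact ⟨Int.floor_le_floor (by gcongr; exact (hxR k hk).1),
      Int.floor_le_floor (by gcongr; exact (hxR k hk).2)⟩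
  have hcard := Finset.card_le_mul_card_image_of_maps_to hmaps ((2 * ⌈1 + M + 1⌉₊ + 1) ^ 2)
    fun b _ => card_le_of_near hh (z := z) (fun k hk => (hz k (Finset.mem_filter.1 hk).1).1) ?_
  · have hnum : ((Finset.Icc ⌊-R / h⌋ ⌊R / h⌋).card : ℝ) ≤ (2 * R + 2) / h := by
      have h1 : ⌊-R / h⌋ ≤ ⌊R / h⌋ + 1 := by
        have : ⌊-R / h⌋ ≤ ⌊R / h⌋ := Int.floor_le_floor (by gcongr; linarith)
        omega
      have h2 : ((Finset.Icc ⌊-R / h⌋ ⌊R / h⌋).card : ℝ) = ⌊R / h⌋ + 1 - ⌊-R / h⌋ := by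
        rw [Int.card_Icc]
        have := Int.toNat_of_nonneg (sub_nonneg.2 h1)
        exact_mod_cast this
      have h3 := Int.floor_le (R / h)
      have h4 := Int.sub_one_lt_floor (-R / h)
      have h5 : 1 ≤ 1 / h := (one_le_div hh).2 hh1
      rw [h2, add_div, mul_div_assoc, show (2 : ℝ) / h = 2 * (1 / h) by ring]
      rw [neg_div] at h4 ⊢
      linarith
    calc (F.card : ℝ) ≤ (2 * ⌈1 + M + 1⌉₊ + 1) ^ 2 * ((Finset.Icc ⌊-R / h⌋ ⌊R / h⌋).card : ℝ) := by
          exact_mod_cast hcard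
      _ ≤ (2 * ⌈1 + M + 1⌉₊ + 1) ^ 2 * ((2 * R + 2) / h) := by gcongr
      _ = _ := by ring
  · intro k hk k' hk'
    obtain ⟨hk, hkb⟩ := Finset.mem_filter.1 hk
    obtain ⟨hk', hkb'⟩ := Finset.mem_filter.1 hk'
    have hdx : |x k - x k'| ≤ h := by
      have h1 := Int.abs_sub_lt_one_of_floor_eq_floor (hkb.trans hkb'.symm)
      rw [← sub_div, abs_div, abs_of_pos hh, div_lt_one hh] at h1
      exact h1.le
    have hy (k : Fin 2 → ℤ) (hk : k ∈ F) : inner ℝ (e 1) (z k - z₀) = ψ (x k) :=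
      hg.eq_of_mem_frontier hs hR (hz k hk).2.1 (hz k hk).2.2
    have hdy : |ψ (x k) - ψ (x k')| ≤ M * h :=
      (hg.holder.lipschitz hs hR (hxR k hk) (hxR k' hk')).trans (by gcongr)
    have hdecomp : z k - z k' = (x k - x k') • e 0 + (ψ (x k) - ψ (x k')) • e 1 := by
      rw [← hy k hk, ← hy k' hk']
      have h1 := e.sum_repr' (z k - z k')
      rw [Fin.sum_univ_two] at h1
      rw [hx]
      dsimp only
      rw [← inner_sub_right, ← inner_sub_right, sub_sub_sub_cancel_right]
      exact h1.symm
    rw [hdecomp]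
    refine (norm_add_le _ _).trans ?_
    rw [norm_smul, norm_smul, e.orthonormal.1, e.orthonormal.1, mul_one, mul_one,
      Real.norm_eq_abs, Real.norm_eq_abs]
    linarith

/-- The compact boundary is covered by finitely many charts, and the bound of each chart is uniform.
-/
theorem IsClassC.exists_card_le {s : ℝ} (hs : 1 ≤ s) {Ω : Set Plane} (hΩ : IsClassC s Ω)
    (hb : Bornology.IsBounded Ω) :
    ∃ K : ℝ, 0 ≤ K ∧ ∀ h : ℝ, 0 < h → h ≤ 1 → ∀ F : Finset (Fin 2 → ℤ),
      (∀ k ∈ F, ∃ z ∈ cell h k, z ∈ frontier Ω) → (F.card : ℝ) ≤ K / h := by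
  obtain ⟨R, M, hR, hM, hg⟩ := hΩ.exists_isLocalGraph
  have hcomp : IsCompact (frontier Ω) :=
    Metric.isCompact_of_isClosed_isBounded isClosed_frontier
      (hb.closure.subset frontier_subset_closure)
  obtain ⟨t, htΩ, ht⟩ := hcomp.elim_nhds_subcover (fun z => Metric.ball z R)
    fun z _ => Metric.ball_mem_nhds z hR
  refine ⟨t.card * ((2 * ⌈1 + M + 1⌉₊ + 1) ^ 2 * (2 * R + 2)), by positivity,
    fun h hh hh1 F hF => ?_⟩
  classical
  have hsub : F ⊆ t.biUnion fun z₀ =>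
      F.filter fun k => ∃ z ∈ cell h k, z ∈ frontier Ω ∧ ‖z - z₀‖ < R := by
    intro k hk
    obtain ⟨z, hz, hzf⟩ := hF k hk
    obtain ⟨z₀, hz₀, hzb⟩ := Set.mem_iUnion₂.1 (ht hzf)
    exact Finset.mem_biUnion.2 ⟨z₀, hz₀,
      Finset.mem_filter.2 ⟨hk, z, hz, hzf, mem_ball_iff_norm.1 hzb⟩⟩
  have hcard : (F.card : ℝ) ≤ ∑ z₀ ∈ t,
      ((F.filter fun k => ∃ z ∈ cell h k, z ∈ frontier Ω ∧ ‖z - z₀‖ < R).card : ℝ) := by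
    exact_mod_cast (Finset.card_le_card hsub).trans Finset.card_biUnion_le
  refine hcard.trans ((Finset.sum_le_card_nsmul t _
    ((2 * ⌈1 + M + 1⌉₊ + 1) ^ 2 * (2 * R + 2) / h) fun z₀ hz₀ => ?_).trans_eq ?_)
  · obtain ⟨e, ψ, hgr⟩ := hg z₀ (htΩ z₀ hz₀)
    exact hgr.card_le hs hR hM hh hh1 fun k hk => (Finset.mem_filter.1 hk).2
  · rw [nsmul_eq_mul]; ring

/-! ### The error on a cell -/

/-- Each coordinate differs by at most 2h, and 2√2 ≤ 3. -/
theorem norm_sub_le_of_mem_stencil {h : ℝ} (hh : 0 < h) {k j : Fin 2 → ℤ} (hj : j ∈ stencil k)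
    {z z₀ : Plane} (hz : z ∈ cell h j) (hz₀ : z₀ ∈ cell h k) : ‖z - z₀‖ ≤ 3 * h := by
  have hc (i : Fin 2) : (z i - z₀ i) ^ 2 ≤ (2 * h) ^ 2 := by
    have h1 := hz i
    have h2 := hz₀ i
    refine sq_le_sq' ?_ ?_ <;> rcases mem_stencil.1 hj i with e | e | e <;> rw [e] at h1 <;>
      push_cast at h1 <;> linarith
  refine le_of_sq_le_sq ?_ (by positivity)
  rw [EuclideanSpace.norm_sq_eq, Fin.sum_univ_two]
  simp only [PiLp.sub_apply, Real.norm_eq_abs, sq_abs]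
  nlinarith [hc 0, hc 1]

theorem IsClassC.exists_cell_error_le {s : ℝ} (hs : 1 ≤ s) {Ω : Set Plane} (hΩ : IsClassC s Ω) :
    ∃ C : ℝ, 0 ≤ C ∧ ∀ h : ℝ, 0 < h → h ≤ 1 → ∀ k : Fin 2 → ℤ, IsSingular h k Ω →
      ∀ p' ∈ cell h k, ∀ n' : Plane, ‖n'‖ = 1 →
        IsMinOn (loss h k (chi Ω)) (linearInterfaces h k) (chi (halfPlane p' n')) →
        volume.real (cell h k ∩ symmDiff Ω (halfPlane p' n')) ≤ C * h ^ (1 + min s 2) := by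
  have hmeas : MeasurableSet Ω := (hΩ.isClosed hs).measurableSet
  obtain ⟨R, M, hR, hM, hg⟩ := hΩ.exists_isLocalGraph
  have hr : 0 < 1 + min s 2 := by positivity
  -- The first term is the minimizer estimate with tangent error on the ball of radius 3h. The
  -- second covers coarse meshes, 3h > R, where the charts are too small but the cell area is at
  -- most 1 < (3h/R)^(1+r).
  refine ⟨37 * (4 * M * 3 ^ (1 + min s 2)) + (3 / R) ^ (1 + min s 2), by positivity,
    fun h hh hh1 k hsing p' hp' n' hn' hmin => ?_⟩
  rcases le_or_gt (3 * h) R with hhR | hhR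
  · obtain ⟨z₀, hz₀, hz₀f⟩ := hsing.exists_mem_frontier
    obtain ⟨e, ψ, hgr⟩ := hg z₀ hz₀f
    obtain ⟨n, hn, happ⟩ := hgr.exists_halfPlane hs hR hM hz₀f
    have hε (j : Fin 2 → ℤ) (hj : j ∈ stencil k) :
        volume.real (cell h j ∩ symmDiff Ω (halfPlane z₀ n)) ≤
          4 * M * (3 * h) ^ (1 + min s 2) := by
      refine (measureReal_mono (Set.inter_subset_inter_left _ fun z hz => ?_) ?_).trans
        (happ (3 * h) (by positivity) hhR)
      · exact mem_closedBall_iff_norm.2 (norm_sub_le_of_mem_stencil hh hj hz hz₀)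
      · exact measure_ne_top_of_subset Set.inter_subset_left
          (isCompact_closedBall z₀ (3 * h)).measure_lt_top.ne
    have hle := volume_real_symmDiff_minimizer_le hh hmeas hz₀ hp' hn'
      (isMinOn_iff.1 hmin _ (mem_linearInterfaces.2 ⟨z₀, hz₀, n, hn, rfl⟩)) hε
    rw [Real.mul_rpow (by norm_num) hh.le] at hle
    have h1 : 0 ≤ (3 / R) ^ (1 + min s 2) * h ^ (1 + min s 2) := by positivity
    linarith
  · have h1 : 1 ≤ (3 / R) ^ (1 + min s 2) * h ^ (1 + min s 2) := by
      rw [← Real.mul_rpow (by positivity) hh.le]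
      refine Real.one_le_rpow ?_ hr.le
      rw [div_mul_eq_mul_div, one_le_div hR]
      exact hhR.le
    have h2 : volume.real (cell h k ∩ symmDiff Ω (halfPlane p' n')) ≤ 1 := by
      refine (measureReal_mono Set.inter_subset_left (volume_cell_ne_top h k)).trans ?_
      rw [volume_real_cell hh.le]
      exact pow_le_one₀ hh.le hh1
    have h3 : 0 ≤ 37 * (4 * M * (3 : ℝ) ^ (1 + min s 2)) * h ^ (1 + min s 2) := by positivity
    linarith

theorem lintegral_enorm_chi_sub_chi (S : Set Plane) {A B : Set Plane}
    (hA : MeasurableSet A) (hB : MeasurableSet B) :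
    ∫⁻ z in S, ‖chi A z - chi B z‖ₑ = volume (S ∩ symmDiff A B) := by
  have h (z : Plane) : ‖chi A z - chi B z‖ₑ = (symmDiff A B).indicator 1 z := by
    by_cases hzA : z ∈ A <;> by_cases hzB : z ∈ B <;>
      simp [chi, hzA, hzB, Set.indicator, Set.mem_symmDiff]
  simp_rw [h]
  rw [lintegral_indicator_one (hA.symmDiff hB), Measure.restrict_apply (hA.symmDiff hB),
    Set.inter_comm]

/-- On a regular cell the characteristic function is almost everywhere 0 or almost everywhere 1,
hence equal to its average. -/
theorem lintegral_enorm_chi_sub_cellAverage {h : ℝ} (hh : 0 < h) {k : Fin 2 → ℤ} {Ω : Set Plane}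
    (hΩ : MeasurableSet Ω) (hs : ¬ IsSingular h k Ω) :
    ∫⁻ z in cell h k, ‖chi Ω z - cellAverage h k (chi Ω)‖ₑ = 0 := by
  have hcell := measurableSet_cell h k
  rw [cellAverage_chi hh k hΩ]
  have hcases : volume (cell h k ∩ Ω) = 0 ∨ volume (cell h k ∩ Ωᶜ) = 0 := by
    unfold IsSingular at hs
    tauto
  rcases hcases with h0 | h0
  · rw [measureReal_def, h0, ENNReal.toReal_zero, zero_div]
    have hae : ∀ᵐ z ∂volume.restrict (cell h k), z ∉ Ω := by
      rw [ae_iff, Measure.restrict_apply' hcell, Set.inter_comm]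
      simpa using h0
    rw [lintegral_congr_ae (g := fun _ => 0), lintegral_zero]
    filter_upwards [hae] with z hz
    simp [chi_of_notMem hz]
  · have hfull : volume.real (cell h k ∩ Ω) = h ^ 2 := by
      have hsplit := measure_inter_add_sdiff (μ := volume) (cell h k) hΩ
      rw [Set.sdiff_eq, h0, add_zero] at hsplit
      rw [measureReal_def, hsplit, ← measureReal_def, volume_real_cell hh.le]
    rw [hfull, div_self (by positivity)]
    have hae : ∀ᵐ z ∂volume.restrict (cell h k), z ∈ Ω := by
      rw [ae_iff, Measure.restrict_apply' hcell, Set.inter_comm]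
      exact h0
    rw [lintegral_congr_ae (g := fun _ => 0), lintegral_zero]
    filter_upwards [hae] with z hz
    simp [chi_of_mem hz]

/-! ### The global error -/

theorem unitSquare_subset_iUnion_cell {l : ℕ} (hl : 0 < l) :
    unitSquare ⊆ ⋃ k : mesh l, cell (1 / (l : ℝ)) k := by
  intro z hz
  have hl' : (0 : ℝ) < l := by exact_mod_cast hl
  have hcoord (i : Fin 2) : ∃ m ∈ Finset.Ico 0 (l : ℤ),
      1 / (l : ℝ) * m ≤ z i ∧ z i ≤ 1 / (l : ℝ) * (m + 1) := by
    obtain ⟨h0, h1⟩ := hz i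
    have key (m : ℤ) : (1 / (l : ℝ) * m ≤ z i ∧ z i ≤ 1 / (l : ℝ) * (m + 1)) ↔
        (m ≤ z i * l ∧ z i * l ≤ m + 1) := by
      rw [one_div_mul_eq_div, one_div_mul_eq_div, div_le_iff₀ hl', le_div_iff₀ hl']
    simp_rw [key, Finset.mem_Ico]
    rcases h1.eq_or_lt with h1 | h1
    -- On the far edge the floor would give l, outside the mesh; the last cell is closed and
    -- contains the edge.
    · refine ⟨l - 1, ⟨by omega, by omega⟩, ?_⟩
      rw [h1]
      push_cast
      constructor <;> linarith
    · refine ⟨⌊z i * l⌋, ⟨Int.floor_nonneg.2 (by positivity), Int.floor_lt.2 ?_⟩,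
        Int.floor_le _, (Int.lt_floor_add_one _).le⟩
      push_cast
      nlinarith
  choose m hm hmz using hcoord
  exact Set.mem_iUnion.2 ⟨⟨m, Fintype.mem_piFinset.2 hm⟩, hmz⟩

/-- Closed cells overlap on their edges, where several terms may contribute. Open cells avoid this,
and the edges are null. -/
theorem sum_mul_chi_cell_eq {h : ℝ} (hh : 0 < h) {F : Finset (Fin 2 → ℤ)} {k : Fin 2 → ℤ}
    (hk : k ∈ F) (w : (Fin 2 → ℤ) → Plane → ℝ) {z : Plane} (hz : z ∈ openCell h k) :
    ∑ j ∈ F, w j z * chi (cell h j) z = w k z := by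
  rw [Finset.sum_eq_single_of_mem k hk, chi_of_mem, mul_one]
  · exact fun i => ⟨(hz i).1.le, (hz i).2.le⟩
  · intro j _ hjk
    rw [chi_of_notMem, mul_zero]
    intro hzj
    refine hjk (funext fun i => ?_)
    have h1 := hz i
    have h2 := hzj i
    have h3 : (j i : ℝ) < k i + 1 := lt_of_mul_lt_mul_left (h2.1.trans_lt h1.2) hh.le
    have h4 : (k i : ℝ) < j i + 1 := lt_of_mul_lt_mul_left (h1.1.trans_le h2.2) hh.le
    have h5 : j i < k i + 1 := by exact_mod_cast h3
    have h6 : k i < j i + 1 := by exact_mod_cast h4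
    omega

theorem isBounded_unitSquare : Bornology.IsBounded unitSquare := by
  refine isBounded_iff_forall_norm_le.2 ⟨2, fun z hz => ?_⟩
  refine le_of_sq_le_sq ?_ (by norm_num)
  rw [EuclideanSpace.norm_sq_eq, Fin.sum_univ_two]
  simp only [Real.norm_eq_abs, sq_abs]
  have h0 := hz 0
  have h1 := hz 1
  nlinarith

theorem IsClassC.exists_error_le {s : ℝ} (hs : 1 ≤ s) {Ω : Set Plane} (hD : Ω ⊆ unitSquare)
    (hΩ : IsClassC s Ω) :
    ∃ C : ℝ, ∀ l : ℕ, 1 < l → ∀ u' : Plane → ℝ, IsReconstruction l Ω u' →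
      eLpNorm (chi Ω - u') 1 (volume.restrict unitSquare)
        ≤ ENNReal.ofReal (C * (1 / (l : ℝ)) ^ min s 2) := by
  have hmeas : MeasurableSet Ω := (hΩ.isClosed hs).measurableSet
  obtain ⟨K, hK, hcount⟩ := hΩ.exists_card_le hs (isBounded_unitSquare.subset hD)
  obtain ⟨C, hC, herr⟩ := hΩ.exists_cell_error_le hs
  -- At most K/h singular cells, each with error at most C h^(1+r).
  refine ⟨K * C, fun l hl u' hu' => ?_⟩
  obtain ⟨w, hw, rfl⟩ := hu'
  have hl1 : (1 : ℝ) ≤ l := by exact_mod_cast hl.le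
  set h : ℝ := 1 / (l : ℝ) with hh_def
  have hh : 0 < h := by positivity
  have hh1 : h ≤ 1 := (div_le_one (by positivity)).2 hl1
  have hcell (k : Fin 2 → ℤ) (hk : k ∈ mesh l) :
      ∫⁻ z in cell h k, ‖chi Ω z - ∑ j ∈ mesh l, w j z * chi (cell h j) z‖ₑ =
        ∫⁻ z in cell h k, ‖chi Ω z - w k z‖ₑ := by
    rw [← setLIntegral_congr (openCell_ae_eq_cell h k), ← setLIntegral_congr
      (openCell_ae_eq_cell h k)]
    refine setLIntegral_congr_fun (measurableSet_openCell h k) fun z hz => ?_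
    simp only [sum_mul_chi_cell_eq hh hk w hz]
  classical
  have hbound (k : Fin 2 → ℤ) (hk : k ∈ mesh l) :
      ∫⁻ z in cell h k, ‖chi Ω z - w k z‖ₑ ≤
        if IsSingular h k Ω then ENNReal.ofReal (C * h ^ (1 + min s 2)) else 0 := by
    split_ifs with hsing
    · obtain ⟨hmem, hmin⟩ := (hw k hk).1 hsing
      obtain ⟨p, hp, n, hn, hwk⟩ := mem_linearInterfaces.1 hmem
      rw [hwk] at hmin ⊢
      rw [lintegral_enorm_chi_sub_chi _ hmeas (measurableSet_halfPlane p n),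
        ← ENNReal.ofReal_toReal (volume_cell_inter_ne_top h k _)]
      exact ENNReal.ofReal_le_ofReal (herr h hh hh1 k hsing p hp n hn hmin)
    · rw [(hw k hk).2 hsing]
      exact (lintegral_enorm_chi_sub_cellAverage hh hmeas hsing).le
  have hcard : (((mesh l).filter fun k => IsSingular h k Ω).card : ℝ) ≤ K / h :=
    hcount h hh hh1 _ fun k hk => (Finset.mem_filter.1 hk).2.exists_mem_frontier
  rw [eLpNorm_one_eq_lintegral_enorm]
  calc ∫⁻ z in unitSquare, ‖(chi Ω - fun z => ∑ j ∈ mesh l, w j z * chi (cell h j) z) z‖ₑ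
      ≤ ∫⁻ z in ⋃ k : mesh l, cell h k,
          ‖chi Ω z - ∑ j ∈ mesh l, w j z * chi (cell h j) z‖ₑ :=
        lintegral_mono_set (unitSquare_subset_iUnion_cell (by omega))
    _ ≤ ∑ k ∈ mesh l, ∫⁻ z in cell h k,
          ‖chi Ω z - ∑ j ∈ mesh l, w j z * chi (cell h j) z‖ₑ := by
        refine (lintegral_iUnion_le _ _).trans_eq ?_
        rw [tsum_fintype]
        exact Finset.sum_coe_sort (mesh l) fun k => ∫⁻ z in cell h k,
          ‖chi Ω z - ∑ j ∈ mesh l, w j z * chi (cell h j) z‖ₑ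
    _ ≤ ∑ k ∈ mesh l,
          if IsSingular h k Ω then ENNReal.ofReal (C * h ^ (1 + min s 2)) else 0 :=
        Finset.sum_le_sum fun k hk => (hcell k hk).trans_le (hbound k hk)
    _ = ENNReal.ofReal
          (((mesh l).filter fun k => IsSingular h k Ω).card * (C * h ^ (1 + min s 2))) := by
        rw [← Finset.sum_filter, Finset.sum_const, nsmul_eq_mul,
          ENNReal.ofReal_mul (Nat.cast_nonneg _), ENNReal.ofReal_natCast]
    _ ≤ ENNReal.ofReal (K / h * (C * h ^ (1 + min s 2))) :=
        ENNReal.ofReal_le_ofReal (mul_le_mul_of_nonneg_right hcard (by positivity))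
    _ = ENNReal.ofReal (K * C * h ^ min s 2) := by
        rw [Real.rpow_add hh, Real.rpow_one]
        congr 1
        field_simp

end LVIRA

end

theorem mainTheorem3 (s : ℝ) (hs : 1 ≤ s) (Ω : Set LVIRA.Plane) (hD : Ω ⊆ LVIRA.unitSquare)
    (hΩ : LVIRA.IsClassC s Ω) :
    (∀ l : ℕ, 1 < l → ∃ u' : LVIRA.Plane → ℝ, LVIRA.IsReconstruction l Ω u') ∧
    ∃ C : ℝ, ∀ l : ℕ, 1 < l → ∀ u' : LVIRA.Plane → ℝ, LVIRA.IsReconstruction l Ω u' →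
      MeasureTheory.eLpNorm (LVIRA.chi Ω - u') 1
          (MeasureTheory.volume.restrict LVIRA.unitSquare)
        ≤ ENNReal.ofReal (C * (1 / (l : ℝ)) ^ min s 2) :=
  ⟨fun _ hl => LVIRA.exists_isReconstruction (by omega) Ω, hΩ.exists_error_le hs hD⟩
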